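/- Let $k$ be a field of characteristic $0$, $\otimes=\otimes_k$, and fix $c\in k\setminus\{0,1,-1\}$. A double bracket on a $k$-algebra $A$ is a $k$-bilinear map $\{\!\{-,-\}\!\}:A\times A\to A\otimes A$ with $\{\!\{a,b\}\!\}=-\{\!\{b,a\}\!\}^\circ$ (where $(d'\otimes d'')^\circ=d''\otimes d'$) and $\{\!\{a,be\}\!\}=\{\!\{a,b\}\!\}e+b\{\!\{a,e\}\!\}$ for the outer bimodule structure. With $\tau(a_1\otimes a_2\otimes a_3)=a_3\otimes a_1\otimes a_2$, it is quasi-Poisson if $\{\!\{a,b,d\}\!\}:=\{\!\{a,\{\!\{b,d\}\!\}'\}\!\}\otimes\{\!\{b,d\}\!\}''+\tau\big(\{\!\{b,\{\!\{d,a\}\!\}'\}\!\}\otimes\{\!\{d,a\}\!\}''\big)+\tau^2\big(\{\!\{d,\{\!\{a,b\}\!\}'\}\!\}\otimes\{\!\{a,b\}\!\}''\big)$ equals $\tfrac14\big(da\otimes b\otimes 1-da\otimes1\otimes b-d\otimes ab\otimes 1+d\otimes a\otimes b-a\otimes b\otimes d+a\otimes1\otimes bd+1\otimes ab\otimes d-1\otimes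 a\otimes bd\big)$ for all $a,b,d\in A$. A multiplicative moment map is an invertible $\Phi\in A$ with $\{\!\{\Phi,a\}\!\}=\tfrac12(a\otimes\Phi-1\otimes\Phi a+a\Phi\otimes1-\Phi\otimes a)$ for all $a$. A quasi-Hamiltonian structure on $A$ is a double quasi-Poisson bracket together with a multiplicative moment map; an isomorphism of quasi-Hamiltonian algebras is an algebra isomorphism intertwining the double brackets and matching the moment maps. Let $F=k\langle x,y\rangle_S$ be the universal localisation at $S=\{1+xy,1+yx\}$, and let $B_1^c=(A_1^c)_{1+xy}$ be the localisation at $1+xy$ of $A_1^c=k\langle x,y\rangle/(1+xy-c(1+yx))$. Then the following hold. 1. $F$ has quasi-Hamiltonian structures $H_1$ and $H_2$, given for $H_1$ (upper signs) and $H_2$ (lower signs) by $\{\!\{x,x\}\!\}=\mp\tfrac12(x^2\otimes1-1\otimes x^2)$, $\{\!\{y,y\}\!\}=\pm\tfrac12(y^2\otimes1-1\otimes y^2)$, $\{\!\{y,x\}\!\}=1\otimes1+\tfrac12\big(xy\otimes1+1\otimes yx\pm(x\otimes y-y\otimes x)\big)$, with moment maps $\Phi_1=(1+yx)(1+xy)^{-1}$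 and $\Phi_2=(1+xy)^{-1}(1+yx)$ respectively. 2. The algebra map $\pi:F\to B_1^c$, $x\mapsto x$, $y\mapsto y$, is surjective, and for $i=1,2$ its kernel is the two-sided ideal generated by $\Phi_i-c^{-1}$. 3. There are algebra automorphisms of $F$ with $\psi:x\mapsto x(1+xy),\ y\mapsto(1+xy)^{-1}y$; $\ \xi:x\mapsto-(1+yx)^{-1}y,\ y\mapsto x$; $\ \varphi_\beta:x\mapsto\beta^{-1}x,\ y\mapsto\beta y$ ($\beta\in k^\times$). Both $\psi$ and $\xi$ are isomorphisms of quasi-Hamiltonian algebras $(F,H_1)\to(F,H_2)$, and each $\varphi_\beta$ is an automorphism of both $(F,H_1)$ and $(F,H_2)$. They induce automorphisms of $B_1^c$ along $\pi$, and these induced automorphisms generate the group $\operatorname{Aut}_k(B_1^c)$. 4. Every $k$-algebra automorphism $\sigma$ of $B_1^c$ is induced by an isomorphism of quasi-Hamiltonian algebras on $F$, possibly between different structures: there are $i,j\in\{1,2\}$ and an isomorphism of quasi-Hamiltonian algebras $f:(F,H_i)\to(F,H_j)$ with $\sigma\circ\pi=\pi\circ f$. -/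

import Mathlib

open scoped TensorProduct

noncomputable section

namespace QuasiHam

/-! ### Double brackets and quasi-Hamiltonian algebras

Algebras are taken over the base `B = k`, i.e. the unit is decomposed with the single idempotent
`1`. Then `B`-linearity of a double bracket (`{1, a} = {a, 1} = 0`) follows from the derivation
rules. -/

section Brackets

variable (k A : Type*) [Field k] [Ring A] [Algebra k A]

/-- A double bracket on `A`: a `k`-bilinear map `A × A → A ⊗ A` which satisfies cyclic antisymmetry
and is a derivation in its second argument for the outer bimodule structure. Multiplying by
`b ⊗ 1` on the left or by `1 ⊗ c` on the right, in the algebra `A ⊗ A`, is the outer action. -/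
structure DoubleBracket where
  /-- the underlying bilinear map -/
  br : A →ₗ[k] A →ₗ[k] A ⊗[k] A
  cyclic_antisymm : ∀ a b : A, br a b = -(TensorProduct.comm k A A (br b a))
  deriv_right : ∀ a b c : A, br a (b * c) = br a b * (1 ⊗ₜ c) + (b ⊗ₜ 1) * br a c

variable {k A}

/-- `cyc (a₁ ⊗ a₂ ⊗ a₃) = a₃ ⊗ a₁ ⊗ a₂`. -/
def cyc : (A ⊗[k] A) ⊗[k] A →ₗ[k] (A ⊗[k] A) ⊗[k] A :=
  (TensorProduct.assoc k A A A).symm.toLinearMap ∘ₗ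
    (TensorProduct.comm k (A ⊗[k] A) A).toLinearMap

theorem cyc_tmul (a b c : A) : cyc (k := k) ((a ⊗ₜ b) ⊗ₜ c) = (c ⊗ₜ a) ⊗ₜ b := by
  simp [cyc]

namespace DoubleBracket

/-- `{a, {b, c}'} ⊗ {b, c}''`. -/
def nested (P : DoubleBracket k A) (a b c : A) : (A ⊗[k] A) ⊗[k] A :=
  LinearMap.rTensor A (P.br a) (P.br b c)

/-- The triple bracket associated with a double bracket. -/
def triple (P : DoubleBracket k A) (a b c : A) : (A ⊗[k] A) ⊗[k] A :=
  P.nested a b c + cyc (P.nested b c a) + cyc (cyc (P.nested c a b))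

/-- A double bracket is quasi-Poisson if its triple bracket is the distinguished one. -/
def IsQuasiPoisson (P : DoubleBracket k A) : Prop :=
  ∀ a b c : A, P.triple a b c = (4 : k)⁻¹ •
    ((((c * a) ⊗ₜ[k] b) ⊗ₜ[k] (1 : A)) - (((c * a) ⊗ₜ[k] (1 : A)) ⊗ₜ[k] b)
      - ((c ⊗ₜ[k] (a * b)) ⊗ₜ[k] (1 : A)) + ((c ⊗ₜ[k] a) ⊗ₜ[k] b)
      - ((a ⊗ₜ[k] b) ⊗ₜ[k] c) + ((a ⊗ₜ[k] (1 : A)) ⊗ₜ[k] (b * c))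
      + (((1 : A) ⊗ₜ[k] (a * b)) ⊗ₜ[k] c) - (((1 : A) ⊗ₜ[k] a) ⊗ₜ[k] (b * c)))

/-- A multiplicative moment map: an invertible element with the multiplicative property. -/
def IsMomentMap (P : DoubleBracket k A) (Φ : A) : Prop :=
  IsUnit Φ ∧ ∀ a : A, P.br Φ a = (2 : k)⁻¹ •
    (a ⊗ₜ[k] Φ - (1 : A) ⊗ₜ[k] (Φ * a) + (a * Φ) ⊗ₜ[k] (1 : A) - Φ ⊗ₜ[k] a)

end DoubleBracket

variable (k A) in
/-- A quasi-Hamiltonian algebra structure on `A`: a double quasi-Poisson bracket together with a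
multiplicative moment map. -/
structure QuasiHamiltonian extends DoubleBracket k A where
  quasiPoisson : toDoubleBracket.IsQuasiPoisson
  /-- the multiplicative moment map -/
  moment : A
  isMomentMap : toDoubleBracket.IsMomentMap moment

/-- An isomorphism of quasi-Hamiltonian algebras: an isomorphism of algebras which intertwines the
double brackets and maps one moment map to the other. -/
def IsQuasiHamiltonianIso {A₁ A₂ : Type*} [Ring A₁] [Algebra k A₁] [Ring A₂] [Algebra k A₂]
    (H₁ : QuasiHamiltonian k A₁) (H₂ : QuasiHamiltonian k A₂) (f : A₁ ≃ₐ[k] A₂) : Prop :=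
  (∀ a b : A₁, H₂.br (f a) (f b) =
    TensorProduct.map f.toLinearMap f.toLinearMap (H₁.br a b)) ∧
  f H₁.moment = H₂.moment

end Brackets

/-! ### Universal localisation of an algebra at a set of elements -/

section Localisation

variable {k A : Type*} [Field k] [Ring A] [Algebra k A]

variable (k) in
/-- Relations of the universal localisation: `Sum.inl a` stands for `a : A`, and `Sum.inr s` for the
formal inverse of `s ∈ S`. -/
inductive UnivLocRel (S : Set A) : FreeAlgebra k (A ⊕ S) → FreeAlgebra k (A ⊕ S) → Prop
  | add (a b : A) : UnivLocRel S (FreeAlgebra.ι k (Sum.inl (a + b)))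
      (FreeAlgebra.ι k (Sum.inl a) + FreeAlgebra.ι k (Sum.inl b))
  | mul (a b : A) : UnivLocRel S (FreeAlgebra.ι k (Sum.inl (a * b)))
      (FreeAlgebra.ι k (Sum.inl a) * FreeAlgebra.ι k (Sum.inl b))
  | scalar (r : k) : UnivLocRel S (FreeAlgebra.ι k (Sum.inl (algebraMap k A r)))
      (algebraMap k (FreeAlgebra k (A ⊕ S)) r)
  | mul_inv (s : S) :
      UnivLocRel S (FreeAlgebra.ι k (Sum.inl (s : A)) * FreeAlgebra.ι k (Sum.inr s)) 1
  | inv_mul (s : S) :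
      UnivLocRel S (FreeAlgebra.ι k (Sum.inr s) * FreeAlgebra.ι k (Sum.inl (s : A))) 1

variable (k) in
/-- The universal localisation `A_S`: the universal `k`-algebra under `A` in which all elements of
`S` become invertible. -/
def UnivLoc (S : Set A) : Type _ := RingQuot (UnivLocRel k S)

namespace UnivLoc

variable (S : Set A)

instance : Ring (UnivLoc k S) := inferInstanceAs (Ring (RingQuot (UnivLocRel k S)))

instance : Algebra k (UnivLoc k S) := inferInstanceAs (Algebra k (RingQuot (UnivLocRel k S)))

/-- The quotient map from the free algebra. -/
def mk : FreeAlgebra k (A ⊕ S) →ₐ[k] UnivLoc k S := RingQuot.mkAlgHom k (UnivLocRel k S)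

theorem mk_rel {p q : FreeAlgebra k (A ⊕ S)} (h : UnivLocRel k S p q) : mk S p = mk S q :=
  RingQuot.mkAlgHom_rel k h

/-- The canonical map `A → A_S`. -/
def of : A →ₐ[k] UnivLoc k S where
  toFun a := mk S (FreeAlgebra.ι k (Sum.inl a))
  map_one' := by
    have h := mk_rel S (UnivLocRel.scalar (S := S) (1 : k))
    simpa using h
  map_mul' a b := by
    have h := mk_rel S (UnivLocRel.mul (k := k) (S := S) a b)
    simpa using h
  map_zero' := by
    have h := mk_rel S (UnivLocRel.scalar (S := S) (0 : k))
    simpa using h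
  map_add' a b := by
    have h := mk_rel S (UnivLocRel.add (k := k) (S := S) a b)
    simpa using h
  commutes' r := by
    have h := mk_rel S (UnivLocRel.scalar (S := S) r)
    simpa using h

/-- An element of `S`, as a unit of `A_S`. -/
def unit (s : S) : (UnivLoc k S)ˣ where
  val := of S (s : A)
  inv := mk S (FreeAlgebra.ι k (Sum.inr s))
  val_inv := by
    have h := mk_rel S (UnivLocRel.mul_inv (k := k) (S := S) s)
    rwa [map_mul, map_one] at h
  inv_val := by
    have h := mk_rel S (UnivLocRel.inv_mul (k := k) (S := S) s)
    rwa [map_mul, map_one] at h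

variable {S}

/-- The universal property of `A_S`. -/
def lift {C : Type*} [Ring C] [Algebra k C] (f : A →ₐ[k] C) (hf : ∀ s : S, IsUnit (f (s : A))) :
    UnivLoc k S →ₐ[k] C :=
  RingQuot.liftAlgHom k
    ⟨FreeAlgebra.lift k (Sum.elim f fun s => (((hf s).unit⁻¹ : Cˣ) : C)), by
      intro p q h
      cases h <;> simp⟩

@[simp]
theorem lift_of {C : Type*} [Ring C] [Algebra k C] (f : A →ₐ[k] C)
    (hf : ∀ s : S, IsUnit (f (s : A))) (a : A) : lift f hf (of S a) = f a := by
  have h := RingQuot.liftAlgHom_mkAlgHom_apply (S := k)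
    (FreeAlgebra.lift k (Sum.elim f fun s : S => (((hf s).unit⁻¹ : Cˣ) : C)))
    (s := UnivLocRel k S) (by intro p q h; cases h <;> simp) (FreeAlgebra.ι k (Sum.inl a))
  exact h.trans (by simp)

end UnivLoc

end Localisation

/-! ### The algebra `k⟨x, y⟩_S` for `S = {1 + xy, 1 + yx}` -/

section Free

variable (k : Type*) [Field k]

/-- The first free generator. -/
def fx : FreeAlgebra k (Fin 2) := FreeAlgebra.ι k 0

/-- The second free generator. -/
def fy : FreeAlgebra k (Fin 2) := FreeAlgebra.ι k 1

/-- The set `{1 + xy, 1 + yx}`. -/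
def locSet : Set (FreeAlgebra k (Fin 2)) := {1 + fx k * fy k, 1 + fy k * fx k}

/-- The localised free algebra `k⟨x, y⟩_S`, `S = {1 + xy, 1 + yx}`. -/
abbrev F2S : Type _ := UnivLoc k (locSet k)

namespace F2S

/-- The generator `x`. -/
def x : F2S k := UnivLoc.of (locSet k) (fx k)

/-- The generator `y`. -/
def y : F2S k := UnivLoc.of (locSet k) (fy k)

/-- The unit `1 + xy`. -/
def u : (F2S k)ˣ := UnivLoc.unit (locSet k) ⟨1 + fx k * fy k, Or.inl rfl⟩

/-- The unit `1 + yx`. -/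
def v : (F2S k)ˣ := UnivLoc.unit (locSet k) ⟨1 + fy k * fx k, Or.inr rfl⟩

theorem u_val : (u k : F2S k) = 1 + x k * y k := by
  change UnivLoc.of (locSet k) (1 + fx k * fy k) = _
  simp [x, y]

theorem v_val : (v k : F2S k) = 1 + y k * x k := by
  change UnivLoc.of (locSet k) (1 + fy k * fx k) = _
  simp [x, y]

variable {k}

/-- The first quasi-Hamiltonian structure on `k⟨x, y⟩_S` (ordering `y < x` at the vertex of the
one-loop quiver with loop `y` and `x = y*`), given on generators, with moment map
`(1 + yx)(1 + xy)⁻¹`. -/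
def IsFirstStructure (H : QuasiHamiltonian k (F2S k)) : Prop :=
  H.br (x k) (x k) = -((2 : k)⁻¹ • ((x k ^ 2) ⊗ₜ[k] (1 : F2S k) - (1 : F2S k) ⊗ₜ[k] (x k ^ 2))) ∧
  H.br (y k) (y k) = (2 : k)⁻¹ • ((y k ^ 2) ⊗ₜ[k] (1 : F2S k) - (1 : F2S k) ⊗ₜ[k] (y k ^ 2)) ∧
  H.br (y k) (x k) = (1 : F2S k) ⊗ₜ[k] (1 : F2S k) + (2 : k)⁻¹ •
    ((x k * y k) ⊗ₜ[k] (1 : F2S k) + (1 : F2S k) ⊗ₜ[k] (y k * x k)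
      + x k ⊗ₜ[k] y k - y k ⊗ₜ[k] x k) ∧
  H.moment = (v k : F2S k) * ((u k)⁻¹ : (F2S k)ˣ)

/-- The second quasi-Hamiltonian structure on `k⟨x, y⟩_S` (opposite ordering `x < y`), given on
generators, with moment map `(1 + xy)⁻¹(1 + yx)`. -/
def IsSecondStructure (H : QuasiHamiltonian k (F2S k)) : Prop :=
  H.br (x k) (x k) = (2 : k)⁻¹ • ((x k ^ 2) ⊗ₜ[k] (1 : F2S k) - (1 : F2S k) ⊗ₜ[k] (x k ^ 2)) ∧
  H.br (y k) (y k) = -((2 : k)⁻¹ • ((y k ^ 2) ⊗ₜ[k] (1 : F2S k) - (1 : F2S k) ⊗ₜ[k] (y k ^ 2))) ∧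
  H.br (y k) (x k) = (1 : F2S k) ⊗ₜ[k] (1 : F2S k) + (2 : k)⁻¹ •
    ((x k * y k) ⊗ₜ[k] (1 : F2S k) + (1 : F2S k) ⊗ₜ[k] (y k * x k)
      - x k ⊗ₜ[k] y k + y k ⊗ₜ[k] x k) ∧
  H.moment = ((u k)⁻¹ : (F2S k)ˣ) * (v k : F2S k)

end F2S

end Free

/-! ### The localised first quantised Weyl algebra -/

section Weyl

variable {k : Type*} [Field k] (c : k)

/-- The relation `1 + xy = c (1 + yx)`. -/
inductive QWeylRel : FreeAlgebra k (Fin 2) → FreeAlgebra k (Fin 2) → Prop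
  | rel : QWeylRel (1 + fx k * fy k) (c • (1 + fy k * fx k))

/-- The first quantised Weyl algebra `A₁ᶜ = k⟨x, y⟩ / (1 + xy - c (1 + yx))`. -/
def QWeyl : Type _ := RingQuot (QWeylRel c)

namespace QWeyl

instance : Ring (QWeyl c) := inferInstanceAs (Ring (RingQuot (QWeylRel c)))

instance : Algebra k (QWeyl c) := inferInstanceAs (Algebra k (RingQuot (QWeylRel c)))

/-- The quotient map `k⟨x, y⟩ → A₁ᶜ`. -/
def mk : FreeAlgebra k (Fin 2) →ₐ[k] QWeyl c := RingQuot.mkAlgHom k (QWeylRel c)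

theorem mk_rel : mk c (1 + fx k * fy k) = c • mk c (1 + fy k * fx k) := by
  have h : mk c (1 + fx k * fy k) = mk c (c • (1 + fy k * fx k)) :=
    RingQuot.mkAlgHom_rel k QWeylRel.rel
  rw [h, map_smul]

end QWeyl

/-- The set `{1 + xy}` in `A₁ᶜ`. -/
def weylSet : Set (QWeyl c) := {QWeyl.mk c (1 + fx k * fy k)}

/-- The localised first quantised Weyl algebra `B₁ᶜ = (A₁ᶜ)_{1 + xy}`. -/
abbrev B1 : Type _ := UnivLoc k (weylSet c)

variable {c}

theorem B1.isUnit_of_locSet (hc : c ≠ 0) (s : locSet k) :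
    IsUnit (((UnivLoc.of (weylSet c)).comp (QWeyl.mk c)) (s : FreeAlgebra k (Fin 2))) := by
  have h1 : IsUnit (UnivLoc.of (weylSet c) (QWeyl.mk c (1 + fx k * fy k))) :=
    (UnivLoc.unit (k := k) (weylSet c) ⟨QWeyl.mk c (1 + fx k * fy k), rfl⟩).isUnit
  obtain ⟨s, rfl | rfl⟩ := s
  · exact h1
  · rw [QWeyl.mk_rel, map_smul] at h1
    have h2 := h1.smul (Units.mk0 c hc)⁻¹
    simpa [Units.smul_def, smul_smul, inv_mul_cancel₀ hc] using h2

/-- The canonical map `k⟨x, y⟩_S → B₁ᶜ`, `x ↦ x`, `y ↦ y`. -/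
def toB1 (hc : c ≠ 0) : F2S k →ₐ[k] B1 c :=
  UnivLoc.lift ((UnivLoc.of (weylSet c)).comp (QWeyl.mk c)) (B1.isUnit_of_locSet hc)

/-- The automorphism `σ` of `B₁ᶜ` is induced by the automorphism `f` of the algebra
`k⟨x, y⟩_S`. -/
def Induces (hc : c ≠ 0) (f : F2S k ≃ₐ[k] F2S k) (σ : B1 c ≃ₐ[k] B1 c) : Prop :=
  ∀ p : F2S k, σ (toB1 hc p) = toB1 hc (f p)

end Weyl

end QuasiHam

end

/-!
A derivation of `k⟨x, y⟩_S` is the off-diagonal entry of a homomorphism into upper triangular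
matrices, so it exists with, and is determined by, arbitrary values on `x` and `y`. The triple
bracket of a double bracket is cyclic and a derivation in its last argument, as is the distinguished
triple bracket (even an inner one); hence the quasi-Poisson identity, the moment map condition and
the compatibility of a homomorphism with brackets need only be checked on generators. The first
structure is obtained in this way, and the second one as its transport by `ξ⁻¹`.

Setting either moment map to `c⁻¹` means `1 + xy = c (1 + yx)`, which gives the kernel of `π` and
lets the automorphisms of `k⟨x, y⟩_S` that respect the structures descend to `B₁ᶜ`. With
`z = 1 + xy` one has `x z = c z x`, and `B₁ᶜ` embeds into the quantum torus
`k⟨X^±, T^±⟩ / (X T - c T X)` by `x ↦ X`, `z ↦ T`. A product of elements of the torus is a monomial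
only if the factors are, and so the units of `B₁ᶜ` are the `r zⁿ`. An automorphism therefore sends
`z` to `r z^{±1}`. Modulo `ξ` the sign is `+`; then, as `c² ≠ 1`, the image of `x` has degree one
and is `f(z) x` for a unit `f`, and such an automorphism is a power of `ξ² φ₋₁` (under which
`x ↦ z x`, `z ↦ z`) times some `φ_β`. Hence the maps induced by `ξ` and the `φ_β` generate the
automorphism group. As `ξ` and the `φ_β` permute the two structures, every automorphism of `B₁ᶜ`
lifts to an automorphism of `k⟨x, y⟩_S` permuting them.
-/

open scoped Pointwise

noncomputable section

namespace QuasiHam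

/-! ### Homomorphisms and derivations out of `k⟨x, y⟩_S` -/

section UniversalProperty

variable {k C : Type*} [Field k] [Ring C] [Algebra k C]

theorem UnivLoc.algHom_ext {A : Type*} [Ring A] [Algebra k A] {S : Set A}
    {f g : UnivLoc k S →ₐ[k] C} (h : f.comp (UnivLoc.of S) = g.comp (UnivLoc.of S)) : f = g := by
  refine RingQuot.ringQuot_ext' k f g (FreeAlgebra.hom_ext (funext ?_))
  rintro (a | s)
  · exact DFunLike.congr_fun h a
  · have hs : Units.map (f : UnivLoc k S →* C) (UnivLoc.unit S s) =
        Units.map (g : UnivLoc k S →* C) (UnivLoc.unit S s) :=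
      Units.ext (DFunLike.congr_fun h (s : A))
    exact congrArg (fun w : Cˣ => ((w⁻¹ : Cˣ) : C)) hs

namespace F2S

theorem algHom_ext {f g : F2S k →ₐ[k] C} (hx : f (x k) = g (x k)) (hy : f (y k) = g (y k)) :
    f = g := by
  refine UnivLoc.algHom_ext (FreeAlgebra.hom_ext (funext fun i => ?_))
  fin_cases i
  exacts [hx, hy]

theorem exists_algHom (a b : C) (hab : IsUnit (1 + a * b)) (hba : IsUnit (1 + b * a)) :
    ∃ f : F2S k →ₐ[k] C, f (x k) = a ∧ f (y k) = b := by
  let g : FreeAlgebra k (Fin 2) →ₐ[k] C := FreeAlgebra.lift k ![a, b]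
  have hgx : g (fx k) = a := by simp [g, fx]
  have hgy : g (fy k) = b := by simp [g, fy]
  refine ⟨UnivLoc.lift g ?_, by rw [x, UnivLoc.lift_of, hgx], by rw [y, UnivLoc.lift_of, hgy]⟩
  rintro ⟨s, rfl | rfl⟩
  · simpa only [map_add, map_one, map_mul, hgx, hgy] using hab
  · simpa only [map_add, map_one, map_mul, hgx, hgy] using hba

theorem isUnit_one_add_map_mul_map (f : F2S k →ₐ[k] C) : IsUnit (1 + f (x k) * f (y k)) := by
  simpa only [u_val, map_add, map_one, map_mul] using (u k).isUnit.map f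

theorem isUnit_one_add_map_mul_map' (f : F2S k →ₐ[k] C) : IsUnit (1 + f (y k) * f (x k)) := by
  simpa only [v_val, map_add, map_one, map_mul] using (v k).isUnit.map f

end F2S

end UniversalProperty

section Triangular

variable {k R : Type*} [CommRing k] [Ring R] [Algebra k R]

variable (k R) in
/-- The algebra of upper triangular `2 × 2` matrices. Derivations are the off-diagonal entries of
homomorphisms into it, so that its unit criterion lets derivations be extended to localisations. -/
def upperTriangular : Subalgebra k (Matrix (Fin 2) (Fin 2) R) where
  carrier := {m | m 1 0 = 0}
  mul_mem' {a b} (ha : a 1 0 = 0) (hb : b 1 0 = 0) := by simp [Matrix.mul_apply, ha, hb]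
  add_mem' {a b} (ha : a 1 0 = 0) (hb : b 1 0 = 0) := by simp [ha, hb]
  algebraMap_mem' r := by simp [Matrix.algebraMap_matrix_apply]

namespace upperTriangular

/-- The upper triangular matrix with diagonal entries `a`, `b` and off-diagonal entry `p`. -/
def of (a p b : R) : upperTriangular k R := ⟨!![a, p; 0, b], by simp [upperTriangular]⟩

theorem of_mul_of (a p b a' p' b' : R) :
    of (k := k) a p b * of a' p' b' = of (a * a') (a * p' + p * b') (b * b') := by
  ext i j; fin_cases i <;> fin_cases j <;> simp [of, Matrix.mul_apply]

theorem of_one : of (k := k) (1 : R) 0 1 = 1 := by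
  ext i j; fin_cases i <;> fin_cases j <;> simp [of]

theorem of_add_of (a p b a' p' b' : R) :
    of (k := k) a p b + of a' p' b' = of (a + a') (p + p') (b + b') := by
  ext i j; fin_cases i <;> fin_cases j <;> simp [of]

theorem smul_of (r : k) (a p b : R) : r • of (k := k) a p b = of (r • a) (r • p) (r • b) := by
  ext i j; fin_cases i <;> fin_cases j <;> simp [of]

theorem isUnit_of {a b : R} (ha : IsUnit a) (hb : IsUnit b) (p : R) :
    IsUnit (of (k := k) a p b) := by
  obtain ⟨a, rfl⟩ := ha
  obtain ⟨b, rfl⟩ := hb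
  refine isUnit_iff_exists.mpr ⟨of ↑a⁻¹ (-(↑a⁻¹ * p * ↑b⁻¹)) ↑b⁻¹, ?_, ?_⟩
  · rw [of_mul_of, ← of_one]; congr 1 <;> simp [mul_assoc]
  · rw [of_mul_of, ← of_one]; congr 1 <;> simp [mul_assoc]

/-- The projection to a diagonal entry. -/
def diag (t : Fin 2) : upperTriangular k R →ₐ[k] R where
  toFun m := m.1 t t
  map_one' := by simp
  map_mul' := by
    rintro ⟨a, ha : a 1 0 = 0⟩ ⟨b, hb : b 1 0 = 0⟩
    fin_cases t <;> simp [Matrix.mul_apply, ha, hb]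
  map_zero' := rfl
  map_add' _ _ := rfl
  commutes' r := by
    change (algebraMap k (Matrix (Fin 2) (Fin 2) R) r) t t = _
    simp [Matrix.algebraMap_matrix_apply]

end upperTriangular

end Triangular

section Derivations

variable {k A R : Type*} [CommRing k] [Ring A] [Algebra k A] [Ring R] [Algebra k R]

/-- `δ` is a derivation for the bimodule structure on `R` in which `A` acts on the left through `i`
and on the right through `j`. -/
def IsDerivAlong (i j : A →ₐ[k] R) (δ : A →ₗ[k] R) : Prop :=
  ∀ a b, δ (a * b) = δ a * j b + i a * δ b

namespace IsDerivAlong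

variable {i j : A →ₐ[k] R} {δ δ' : A →ₗ[k] R}

theorem add (h : IsDerivAlong i j δ) (h' : IsDerivAlong i j δ') : IsDerivAlong i j (δ + δ') :=
  fun a b => by simp only [LinearMap.add_apply, h a b, h' a b]; noncomm_ring

theorem smul (h : IsDerivAlong i j δ) (r : k) : IsDerivAlong i j (r • δ) := fun a b => by
  simp [h a b]

theorem mulLeft (h : IsDerivAlong i j δ) {s : R} (hs : ∀ a, Commute s (i a)) :
    IsDerivAlong i j (LinearMap.mulLeft k s ∘ₗ δ) := fun a b => by
  simp only [LinearMap.comp_apply, LinearMap.mulLeft_apply, h a b, mul_add, ← mul_assoc, (hs a).eq]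

theorem mulRight (h : IsDerivAlong i j δ) {s : R} (hs : ∀ a, Commute s (j a)) :
    IsDerivAlong i j (LinearMap.mulRight k s ∘ₗ δ) := fun a b => by
  simp only [LinearMap.comp_apply, LinearMap.mulRight_apply, h a b, add_mul, mul_assoc, (hs b).eq]

theorem algHom_comp {R' : Type*} [Ring R'] [Algebra k R'] (h : IsDerivAlong i j δ)
    (g : R →ₐ[k] R') : IsDerivAlong (g.comp i) (g.comp j) (g.toLinearMap ∘ₗ δ) := fun a b => by
  simp [h a b]

theorem comp_algHom {A' : Type*} [Ring A'] [Algebra k A'] (h : IsDerivAlong i j δ)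
    (f : A' →ₐ[k] A) : IsDerivAlong (i.comp f) (j.comp f) (δ ∘ₗ f.toLinearMap) := fun a b => by
  simp [h (f a) (f b)]

theorem map_one (h : IsDerivAlong i j δ) : δ 1 = 0 := by simpa using h 1 1

/-- The homomorphism into upper triangular matrices whose off-diagonal entry is `δ`. -/
def toUpperTriangular (h : IsDerivAlong i j δ) : A →ₐ[k] upperTriangular k R :=
  AlgHom.ofLinearMap
    { toFun := fun a => upperTriangular.of (i a) (δ a) (j a)
      map_add' := fun a b => by simp [upperTriangular.of_add_of]
      map_smul' := fun r a => by simp [upperTriangular.smul_of] }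
    (by simp [h.map_one, upperTriangular.of_one])
    (fun a b => by simp [upperTriangular.of_mul_of, h a b, add_comm])

theorem toUpperTriangular_apply (h : IsDerivAlong i j δ) (a : A) :
    h.toUpperTriangular a = upperTriangular.of (i a) (δ a) (j a) := rfl

end IsDerivAlong

/-- `B` is a derivation in its second argument along `(i, j)` and in its first argument along
`(i', j')`. Double brackets are the case of the outer and the inner bimodule structure on
`A ⊗ A`. -/
structure IsBiderivAlong (i j i' j' : A →ₐ[k] R) (B : A →ₗ[k] A →ₗ[k] R) : Prop where
  right : ∀ a, IsDerivAlong i j (B a)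
  left : ∀ b, IsDerivAlong i' j' (B.flip b)

end Derivations

section FreeDerivations

variable {k R : Type*} [Field k] [Ring R] [Algebra k R]

namespace F2S

variable {i j : F2S k →ₐ[k] R} {δ δ' : F2S k →ₗ[k] R}

theorem deriv_ext (h : IsDerivAlong i j δ) (h' : IsDerivAlong i j δ') (hx : δ (x k) = δ' (x k))
    (hy : δ (y k) = δ' (y k)) : δ = δ' := by
  have heq : h.toUpperTriangular = h'.toUpperTriangular := algHom_ext
    (by simp only [IsDerivAlong.toUpperTriangular_apply, hx])
    (by simp only [IsDerivAlong.toUpperTriangular_apply, hy])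
  ext a
  exact congrArg (fun m : upperTriangular k R => m.1 0 1) (DFunLike.congr_fun heq a)

theorem exists_deriv (i j : F2S k →ₐ[k] R) (p q : R) :
    ∃ δ : F2S k →ₗ[k] R, IsDerivAlong i j δ ∧ δ (x k) = p ∧ δ (y k) = q := by
  obtain ⟨f, hfx, hfy⟩ := exists_algHom (k := k)
    (upperTriangular.of (k := k) (i (x k)) p (j (x k)))
    (upperTriangular.of (k := k) (i (y k)) q (j (y k)))
    (by
      rw [upperTriangular.of_mul_of, ← upperTriangular.of_one, upperTriangular.of_add_of]
      exact upperTriangular.isUnit_of (isUnit_one_add_map_mul_map i)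
        (isUnit_one_add_map_mul_map j) _)
    (by
      rw [upperTriangular.of_mul_of, ← upperTriangular.of_one, upperTriangular.of_add_of]
      exact upperTriangular.isUnit_of (isUnit_one_add_map_mul_map' i)
        (isUnit_one_add_map_mul_map' j) _)
  have hi : (upperTriangular.diag 0).comp f = i := algHom_ext
    (by rw [AlgHom.comp_apply, hfx]; rfl) (by rw [AlgHom.comp_apply, hfy]; rfl)
  have hj : (upperTriangular.diag 1).comp f = j := algHom_ext
    (by rw [AlgHom.comp_apply, hfx]; rfl) (by rw [AlgHom.comp_apply, hfy]; rfl)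
  refine ⟨{ toFun := fun a => (f a).1 0 1, map_add' := by simp, map_smul' := by simp },
    fun a b => ?_, by simp [hfx, upperTriangular.of], by simp [hfy, upperTriangular.of]⟩
  have hia : (f a).1 0 0 = i a := DFunLike.congr_fun hi a
  have hjb : (f b).1 1 1 = j b := DFunLike.congr_fun hj b
  simp [Matrix.mul_apply, hia, hjb, add_comm]

variable {i' j' : F2S k →ₐ[k] R}

theorem bideriv_ext {B B' : F2S k →ₗ[k] F2S k →ₗ[k] R} (h : IsBiderivAlong i j i' j' B)
    (h' : IsBiderivAlong i j i' j' B') (hxx : B (x k) (x k) = B' (x k) (x k))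
    (hyy : B (y k) (y k) = B' (y k) (y k)) (hxy : B (x k) (y k) = B' (x k) (y k))
    (hyx : B (y k) (x k) = B' (y k) (x k)) : B = B' := by
  have hx : B.flip (x k) = B'.flip (x k) := deriv_ext (h.left _) (h'.left _) hxx hyx
  have hy : B.flip (y k) = B'.flip (y k) := deriv_ext (h.left _) (h'.left _) hxy hyy
  ext1 a
  exact deriv_ext (h.right a) (h'.right a) (DFunLike.congr_fun hx a) (DFunLike.congr_fun hy a)

theorem exists_bideriv (hi : ∀ a b, Commute (i' a) (i b)) (hj : ∀ a b, Commute (j' a) (j b))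
    {δx δy : F2S k →ₗ[k] R} (hδx : IsDerivAlong i' j' δx) (hδy : IsDerivAlong i' j' δy) :
    ∃ B : F2S k →ₗ[k] F2S k →ₗ[k] R, IsBiderivAlong i j i' j' B ∧
      B.flip (x k) = δx ∧ B.flip (y k) = δy := by
  choose D hD hDx hDy using exists_deriv i j
  let B : F2S k →ₗ[k] F2S k →ₗ[k] R :=
    { toFun := fun a => D (δx a) (δy a)
      map_add' := fun a b => deriv_ext (hD _ _) ((hD _ _).add (hD _ _))
        (by simp [hDx]) (by simp [hDy])
      map_smul' := fun r a => deriv_ext (hD _ _) ((hD _ _).smul r)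
        (by simp [hDx]) (by simp [hDy]) }
  have hBx (a : F2S k) : B a (x k) = δx a := hDx _ _
  have hBy (a : F2S k) : B a (y k) = δy a := hDy _ _
  have hB (a : F2S k) : IsDerivAlong i j (B a) := hD _ _
  refine ⟨B, ⟨hB, fun b a a' => ?_⟩, LinearMap.ext hBx, LinearMap.ext hBy⟩
  refine DFunLike.congr_fun (deriv_ext (hB (a * a')) (((hB a).mulRight (hj a')).add
    ((hB a').mulLeft (hi a))) ?_ ?_) b
  · simpa [hBx] using hδx a a'
  · simpa [hBy] using hδy a a'

end F2S

end FreeDerivations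

section Brackets

variable {k A : Type*} [Field k] [Ring A] [Algebra k A]

/-- The inclusion `a ↦ a ⊗ 1`. -/
abbrev inl : A →ₐ[k] A ⊗[k] A := Algebra.TensorProduct.includeLeft

/-- The inclusion `a ↦ 1 ⊗ a`. -/
abbrev inr : A →ₐ[k] A ⊗[k] A := Algebra.TensorProduct.includeRight

/-- The flip `a ⊗ b ↦ b ⊗ a`, as a homomorphism of algebras. -/
abbrev swap : A ⊗[k] A →ₐ[k] A ⊗[k] A := (Algebra.TensorProduct.comm k A A).toAlgHom

theorem swap_comp_inl : (swap (k := k) (A := A)).comp inl = inr := by ext; simp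

theorem swap_comp_inr : (swap (k := k) (A := A)).comp inr = inl := by ext; simp

theorem swap_swap (s : A ⊗[k] A) : swap (swap s) = s :=
  (Algebra.TensorProduct.comm k A A).left_inv s

theorem commute_inl_inr (a b : A) : Commute (inl (k := k) a) (inr b) := by
  simp [Commute, SemiconjBy]

namespace DoubleBracket

theorem antisymm (P : DoubleBracket k A) (a b : A) : P.br a b = -swap (P.br b a) :=
  P.cyclic_antisymm a b

theorem isBiderivAlong (P : DoubleBracket k A) : IsBiderivAlong inl inr inr inl P.br where
  right a b c := P.deriv_right a b c
  left a b c := by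
    simp only [LinearMap.flip_apply, P.antisymm _ a, P.deriv_right]
    simp [add_comm]

theorem deriv_left (P : DoubleBracket k A) (a b c : A) :
    P.br (a * b) c = (1 ⊗ₜ a) * P.br b c + P.br a c * (b ⊗ₜ 1) :=
  (P.isBiderivAlong.left c a b).trans (add_comm _ _)

end DoubleBracket

theorem isBiderivAlong_neg_swap_flip {B : A →ₗ[k] A →ₗ[k] A ⊗[k] A}
    (hB : IsBiderivAlong inl inr inr inl B) :
    IsBiderivAlong inl inr inr inl (-(B.flip.compr₂ swap.toLinearMap)) where
  right a := by
    have h := ((hB.left a).algHom_comp swap).smul (-1)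
    rw [swap_comp_inl, swap_comp_inr] at h
    exact fun b c => by simpa using h b c
  left a := by
    have h := ((hB.right a).algHom_comp swap).smul (-1)
    rw [swap_comp_inl, swap_comp_inr] at h
    exact fun b c => by simpa using h b c

theorem F2S.exists_doubleBracket {p q : F2S k ⊗[k] F2S k} (r : F2S k ⊗[k] F2S k)
    (hp : p = -swap p) (hq : q = -swap q) :
    ∃ P : DoubleBracket k (F2S k), P.br (x k) (x k) = p ∧ P.br (y k) (y k) = q ∧
      P.br (y k) (x k) = r := by
  obtain ⟨δx, hδx, hxx, hyx⟩ := exists_deriv (k := k) inr inl p r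
  obtain ⟨δy, hδy, hxy, hyy⟩ := exists_deriv (k := k) inr inl (-swap r) q
  obtain ⟨B, hB, rfl, rfl⟩ := exists_bideriv (i := inl) (j := inr)
    (fun a b => (commute_inl_inr b a).symm) (fun a b => commute_inl_inr a b) hδx hδy
  rw [LinearMap.flip_apply] at hxx hyx hxy hyy
  have hanti : B = -(B.flip.compr₂ swap.toLinearMap) := by
    refine bideriv_ext hB (isBiderivAlong_neg_swap_flip hB) ?_ ?_ ?_ ?_
    · change _ = -swap (B (x k) (x k))
      rwa [hxx]
    · change _ = -swap (B (y k) (y k))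
      rwa [hyy]
    · change _ = -swap (B (y k) (x k))
      rw [hxy, hyx]
    · change _ = -swap (B (x k) (y k))
      rw [hxy, hyx, map_neg, neg_neg, swap_swap]
  exact ⟨⟨B, fun a b => congrArg (fun B => B a b) hanti, hB.right⟩, hxx, hyy, hyx⟩

end Brackets

/-! ### Transport of structure and verification on generators -/

section Naturality

variable {k A B : Type*} [Field k] [Ring A] [Algebra k A] [Ring B] [Algebra k B]

theorem swap_map (f : A →ₐ[k] B) (s : A ⊗[k] A) :
    swap (TensorProduct.map f.toLinearMap f.toLinearMap s) =
      TensorProduct.map f.toLinearMap f.toLinearMap (swap s) :=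
  (TensorProduct.map_comm f.toLinearMap f.toLinearMap s).symm

theorem F2S.br_map_of_generators (P : DoubleBracket k (F2S k)) (Q : DoubleBracket k A)
    (f : F2S k →ₐ[k] A)
    (hxx : Q.br (f (x k)) (f (x k)) =
      TensorProduct.map f.toLinearMap f.toLinearMap (P.br (x k) (x k)))
    (hyy : Q.br (f (y k)) (f (y k)) =
      TensorProduct.map f.toLinearMap f.toLinearMap (P.br (y k) (y k)))
    (hyx : Q.br (f (y k)) (f (x k)) =
      TensorProduct.map f.toLinearMap f.toLinearMap (P.br (y k) (x k))) (a b : F2S k) :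
    Q.br (f a) (f b) = TensorProduct.map f.toLinearMap f.toLinearMap (P.br a b) := by
  have hQ : IsBiderivAlong (inl.comp f) (inr.comp f) (inr.comp f) (inl.comp f)
      (Q.br.compl₁₂ f.toLinearMap f.toLinearMap) :=
    ⟨fun a => (Q.isBiderivAlong.right (f a)).comp_algHom f,
      fun b => (Q.isBiderivAlong.left (f b)).comp_algHom f⟩
  have hinl : (Algebra.TensorProduct.map f f).comp inl = inl.comp f := by ext; simp
  have hinr : (Algebra.TensorProduct.map f f).comp inr = inr.comp f := by ext; simp
  have hP : IsBiderivAlong (inl.comp f) (inr.comp f) (inr.comp f) (inl.comp f)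
      (P.br.compr₂ (Algebra.TensorProduct.map f f).toLinearMap) := by
    rw [← hinl, ← hinr]
    exact ⟨fun a => (P.isBiderivAlong.right a).algHom_comp _,
      fun b => (P.isBiderivAlong.left b).algHom_comp _⟩
  have hxy : Q.br (f (x k)) (f (y k)) =
      TensorProduct.map f.toLinearMap f.toLinearMap (P.br (x k) (y k)) := by
    rw [Q.antisymm, P.antisymm, hyx, swap_map, map_neg]
  exact LinearMap.congr_fun₂ (bideriv_ext hQ hP hxx hyy hxy hyx) a b

/-- The threefold tensor power of a linear map. -/
abbrev map3 (f : A →ₗ[k] B) : (A ⊗[k] A) ⊗[k] A →ₗ[k] (B ⊗[k] B) ⊗[k] B :=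
  TensorProduct.map (TensorProduct.map f f) f

theorem cyc_map3 (f : A →ₗ[k] B) (s : (A ⊗[k] A) ⊗[k] A) : cyc (map3 f s) = map3 f (cyc s) := by
  have h : cyc ∘ₗ map3 f = map3 f ∘ₗ cyc :=
    TensorProduct.ext_threefold fun a b c => by simp [cyc_tmul]
  exact DFunLike.congr_fun h s

namespace DoubleBracket

/-- The transport of a double bracket along an isomorphism. -/
def transport (P : DoubleBracket k A) (e : A ≃ₐ[k] B) : DoubleBracket k B where
  br := (P.br.compl₁₂ e.symm.toLinearMap e.symm.toLinearMap).compr₂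
    (TensorProduct.map e.toAlgHom.toLinearMap e.toAlgHom.toLinearMap)
  cyclic_antisymm a b := by
    change TensorProduct.map _ _ (P.br (e.symm a) (e.symm b)) =
      -swap (TensorProduct.map _ _ (P.br (e.symm b) (e.symm a)))
    rw [swap_map, P.antisymm, map_neg]
  deriv_right a b c := by
    change Algebra.TensorProduct.map e.toAlgHom e.toAlgHom (P.br (e.symm a) (e.symm (b * c))) =
      Algebra.TensorProduct.map e.toAlgHom e.toAlgHom (P.br (e.symm a) (e.symm b)) * (1 ⊗ₜ c) +
        (b ⊗ₜ 1) *
          Algebra.TensorProduct.map e.toAlgHom e.toAlgHom (P.br (e.symm a) (e.symm c))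
    simp [P.deriv_right]

theorem transport_br (P : DoubleBracket k A) (e : A ≃ₐ[k] B) (a b : B) :
    (P.transport e).br a b =
      TensorProduct.map e.toLinearMap e.toLinearMap (P.br (e.symm a) (e.symm b)) := rfl

theorem transport_nested (P : DoubleBracket k A) (e : A ≃ₐ[k] B) (a b c : B) :
    (P.transport e).nested a b c =
      map3 e.toLinearMap (P.nested (e.symm a) (e.symm b) (e.symm c)) := by
  simp only [nested, transport_br]
  induction P.br (e.symm b) (e.symm c) with
  | zero => simp only [map_zero]
  | tmul p q => simp [transport_br]
  | add s t hs ht => simp only [map_add, hs, ht]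

theorem IsQuasiPoisson.transport {P : DoubleBracket k A} (h : P.IsQuasiPoisson)
    (e : A ≃ₐ[k] B) : (P.transport e).IsQuasiPoisson := by
  intro a b c
  have htriple : (P.transport e).triple a b c =
      map3 e.toLinearMap (P.triple (e.symm a) (e.symm b) (e.symm c)) := by
    simp only [triple, transport_nested, cyc_map3, map_add]
  rw [htriple, h]
  simp

theorem IsMomentMap.transport {P : DoubleBracket k A} {Φ : A} (h : P.IsMomentMap Φ)
    (e : A ≃ₐ[k] B) : (P.transport e).IsMomentMap (e Φ) := by
  refine ⟨h.1.map e, fun a => ?_⟩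
  rw [transport_br, e.symm_apply_apply, h.2]
  simp

end DoubleBracket

namespace QuasiHamiltonian

theorem ext_br_moment {H H' : QuasiHamiltonian k A} (hbr : ∀ a b, H.br a b = H'.br a b)
    (hmoment : H.moment = H'.moment) : H = H' := by
  obtain ⟨⟨br, _, _⟩, _, _, _⟩ := H
  obtain ⟨⟨br', _, _⟩, _, _, _⟩ := H'
  obtain rfl : br = br' := LinearMap.ext₂ hbr
  cases hmoment
  rfl

/-- The transport of a quasi-Hamiltonian structure along an isomorphism. -/
def transport (H : QuasiHamiltonian k A) (e : A ≃ₐ[k] B) : QuasiHamiltonian k B where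
  toDoubleBracket := H.toDoubleBracket.transport e
  quasiPoisson := H.quasiPoisson.transport e
  moment := e H.moment
  isMomentMap := H.isMomentMap.transport e

/-- Automorphisms of an algebra act on its quasi-Hamiltonian structures by transport. -/
instance : MulAction (A ≃ₐ[k] A) (QuasiHamiltonian k A) where
  smul f H := H.transport f
  one_smul H := ext_br_moment
    (fun a b => by
      change TensorProduct.map LinearMap.id LinearMap.id (H.br a b) = _
      rw [TensorProduct.map_id, LinearMap.id_apply]) rfl
  mul_smul f g H := ext_br_moment
    (fun a b => by
      change TensorProduct.map (f.toLinearMap ∘ₗ g.toLinearMap) (f.toLinearMap ∘ₗ g.toLinearMap)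
        (H.br (g.symm (f.symm a)) (g.symm (f.symm b))) = _
      rw [TensorProduct.map_comp, LinearMap.comp_apply]
      rfl) rfl

theorem smul_br (f : A ≃ₐ[k] A) (H : QuasiHamiltonian k A) (a b : A) :
    (f • H).br (f a) (f b) = TensorProduct.map f.toLinearMap f.toLinearMap (H.br a b) := by
  change TensorProduct.map _ _ (H.br (f.symm (f a)) (f.symm (f b))) = _
  rw [f.symm_apply_apply, f.symm_apply_apply]
  rfl

end QuasiHamiltonian

theorem isQuasiHamiltonianIso_iff_smul_eq {H H' : QuasiHamiltonian k A} {f : A ≃ₐ[k] A} :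
    IsQuasiHamiltonianIso H H' f ↔ f • H = H' := by
  refine ⟨fun h => QuasiHamiltonian.ext_br_moment (fun a b => ?_) h.2, ?_⟩
  · obtain ⟨a, rfl⟩ := f.surjective a
    obtain ⟨b, rfl⟩ := f.surjective b
    rw [QuasiHamiltonian.smul_br, h.1]
  · rintro rfl
    exact ⟨fun a b => QuasiHamiltonian.smul_br f H a b, rfl⟩

theorem F2S.smul_eq_of_generators {H H' : QuasiHamiltonian k (F2S k)} {f : F2S k ≃ₐ[k] F2S k}
    (hxx : H'.br (f (x k)) (f (x k)) =
      TensorProduct.map f.toLinearMap f.toLinearMap (H.br (x k) (x k)))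
    (hyy : H'.br (f (y k)) (f (y k)) =
      TensorProduct.map f.toLinearMap f.toLinearMap (H.br (y k) (y k)))
    (hyx : H'.br (f (y k)) (f (x k)) =
      TensorProduct.map f.toLinearMap f.toLinearMap (H.br (y k) (x k)))
    (hmoment : f H.moment = H'.moment) : f • H = H' :=
  isQuasiHamiltonianIso_iff_smul_eq.1
    ⟨br_map_of_generators H.toDoubleBracket H'.toDoubleBracket f.toAlgHom hxx hyy hyx, hmoment⟩

end Naturality

section QuasiPoisson

variable {k A : Type*} [Field k] [Ring A] [Algebra k A]

/-- The inner derivation `a ↦ i a * s - s * j a`. -/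
def innerDeriv {R : Type*} [Ring R] [Algebra k R] (i j : A →ₐ[k] R) (s : R) : A →ₗ[k] R :=
  LinearMap.mulRight k s ∘ₗ i.toLinearMap - LinearMap.mulLeft k s ∘ₗ j.toLinearMap

theorem innerDeriv_apply {R : Type*} [Ring R] [Algebra k R] (i j : A →ₐ[k] R) (s : R) (a : A) :
    innerDeriv i j s a = i a * s - s * j a := rfl

theorem isDerivAlong_innerDeriv {R : Type*} [Ring R] [Algebra k R] (i j : A →ₐ[k] R) (s : R) :
    IsDerivAlong i j (innerDeriv i j s) := fun a b => by
  simp only [innerDeriv_apply, map_mul]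
  noncomm_ring

/-- The embedding `a ↦ a ⊗ 1 ⊗ 1`. -/
abbrev leg1 : A →ₐ[k] (A ⊗[k] A) ⊗[k] A := Algebra.TensorProduct.includeLeft.comp inl

/-- The embedding `a ↦ 1 ⊗ a ⊗ 1`. -/
abbrev leg2 : A →ₐ[k] (A ⊗[k] A) ⊗[k] A := Algebra.TensorProduct.includeLeft.comp inr

/-- The embedding `a ↦ 1 ⊗ 1 ⊗ a`. -/
abbrev leg3 : A →ₐ[k] (A ⊗[k] A) ⊗[k] A := Algebra.TensorProduct.includeRight

/-- The embedding `a ⊗ b ↦ a ⊗ b ⊗ 1`. -/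
abbrev leg12 : A ⊗[k] A →ₐ[k] (A ⊗[k] A) ⊗[k] A := Algebra.TensorProduct.includeLeft

/-- The embedding `a ⊗ b ↦ a ⊗ 1 ⊗ b`. -/
abbrev leg13 : A ⊗[k] A →ₐ[k] (A ⊗[k] A) ⊗[k] A := Algebra.TensorProduct.map inl (AlgHom.id k A)

/-- The embedding `a ⊗ b ↦ 1 ⊗ a ⊗ b`. -/
abbrev leg23 : A ⊗[k] A →ₐ[k] (A ⊗[k] A) ⊗[k] A := Algebra.TensorProduct.map inr (AlgHom.id k A)

theorem cyc_mul (s t : (A ⊗[k] A) ⊗[k] A) : cyc (s * t) = cyc s * cyc t :=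
  map_mul ((Algebra.TensorProduct.comm k (A ⊗[k] A) A).trans
    (Algebra.TensorProduct.assoc k k k A A A).symm) s t

theorem cyc_cyc_cyc (s : (A ⊗[k] A) ⊗[k] A) : cyc (cyc (cyc s)) = s := by
  have h : cyc ∘ₗ cyc ∘ₗ cyc = (LinearMap.id : (A ⊗[k] A) ⊗[k] A →ₗ[k] _) :=
    TensorProduct.ext_threefold fun a b c => by simp [cyc_tmul]
  exact DFunLike.congr_fun h s

theorem cyc_leg1 (a : A) : cyc (k := k) (leg1 a) = leg2 a := cyc_tmul a 1 1

theorem cyc_leg2 (a : A) : cyc (k := k) (leg2 a) = leg3 a := cyc_tmul 1 a 1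

theorem cyc_leg3 (a : A) : cyc (k := k) (leg3 a) = leg1 a := cyc_tmul 1 1 a

theorem cyc_leg12 (s : A ⊗[k] A) : cyc (leg12 s) = leg23 s := by
  have h : cyc ∘ₗ (leg12 (k := k) (A := A)).toLinearMap = (leg23 (k := k)).toLinearMap :=
    TensorProduct.ext' fun a b => by simp [cyc_tmul]
  exact DFunLike.congr_fun h s

theorem cyc_leg13 (s : A ⊗[k] A) : cyc (leg13 s) = leg12 (swap s) := by
  have h : cyc ∘ₗ (leg13 (k := k) (A := A)).toLinearMap =
      ((leg12 (k := k)).comp swap).toLinearMap :=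
    TensorProduct.ext' fun a b => by simp [cyc_tmul]
  exact DFunLike.congr_fun h s

variable (k) in
/-- The distinguished triple bracket, up to the factor `1 / 4`. -/
def distinguished (a b c : A) : (A ⊗[k] A) ⊗[k] A :=
  (((c * a) ⊗ₜ[k] b) ⊗ₜ[k] (1 : A)) - (((c * a) ⊗ₜ[k] (1 : A)) ⊗ₜ[k] b)
      - ((c ⊗ₜ[k] (a * b)) ⊗ₜ[k] (1 : A)) + ((c ⊗ₜ[k] a) ⊗ₜ[k] b)
      - ((a ⊗ₜ[k] b) ⊗ₜ[k] c) + ((a ⊗ₜ[k] (1 : A)) ⊗ₜ[k] (b * c))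
      + (((1 : A) ⊗ₜ[k] (a * b)) ⊗ₜ[k] c) - (((1 : A) ⊗ₜ[k] a) ⊗ₜ[k] (b * c))

theorem distinguished_eq_innerDeriv (a b c : A) : distinguished k a b c =
    innerDeriv leg1 leg3 (((a ⊗ₜ b) ⊗ₜ 1) - ((a ⊗ₜ 1) ⊗ₜ b) - ((1 ⊗ₜ (a * b)) ⊗ₜ 1) +
      ((1 ⊗ₜ a) ⊗ₜ b)) c := by
  simp only [distinguished, innerDeriv_apply, AlgHom.comp_apply,
    Algebra.TensorProduct.includeLeft_apply, Algebra.TensorProduct.includeRight_apply,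
    Algebra.TensorProduct.one_def, mul_add, add_mul, mul_sub, sub_mul,
    Algebra.TensorProduct.tmul_mul_tmul, mul_one, one_mul]
  abel

theorem cyc_distinguished (a b c : A) : cyc (distinguished k b c a) = distinguished k a b c := by
  simp only [distinguished, map_add, map_sub, cyc_tmul]
  abel

namespace DoubleBracket

variable (P : DoubleBracket k A)

/-- The map `s ↦ {a, s'} ⊗ s''`. -/
abbrev nest (a : A) : A ⊗[k] A →ₗ[k] (A ⊗[k] A) ⊗[k] A := LinearMap.rTensor A (P.br a)

theorem nest_mul_inr (a d : A) (s : A ⊗[k] A) :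
    P.nest a (s * inr d) = P.nest a s * leg3 d := by
  induction s with
  | zero => simp only [map_zero, zero_mul]
  | tmul p q => simp
  | add s t hs ht => simp only [map_add, add_mul, hs, ht]

theorem nest_inr_mul (b c : A) (s : A ⊗[k] A) :
    P.nest b (inr c * s) = leg3 c * P.nest b s := by
  induction s with
  | zero => simp only [map_zero, mul_zero]
  | tmul p q => simp
  | add s t hs ht => simp only [map_add, mul_add, hs, ht]

theorem nest_inl_mul (a c : A) (s : A ⊗[k] A) :
    P.nest a (inl c * s) = leg1 c * P.nest a s + leg12 (P.br a c) * leg23 s := by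
  induction s with
  | zero => simp only [map_zero, mul_zero, add_zero]
  | tmul p q => simp [P.deriv_right, TensorProduct.add_tmul, add_comm]
  | add s t hs ht => simp only [map_add, mul_add, hs, ht]; abel

theorem nest_mul_inl (b d : A) (s : A ⊗[k] A) :
    P.nest b (s * inl d) = P.nest b s * leg2 d + leg13 s * leg12 (P.br b d) := by
  induction s with
  | zero => simp only [map_zero, zero_mul, add_zero]
  | tmul p q => simp [P.deriv_right, TensorProduct.add_tmul]
  | add s t hs ht => simp only [map_add, add_mul, hs, ht]; abel

theorem nest_mul (c d : A) (s : A ⊗[k] A) :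
    P.nest (c * d) s = P.nest c s * leg1 d + leg2 c * P.nest d s := by
  induction s with
  | zero => simp only [map_zero, zero_mul, mul_zero, add_zero]
  | tmul p q => simp [P.deriv_left, TensorProduct.add_tmul, add_comm]
  | add s t hs ht => simp only [map_add, mul_add, add_mul, hs, ht]; abel

/-- The triple bracket as a linear map in its last argument. -/
def tripleHom (a b : A) : A →ₗ[k] (A ⊗[k] A) ⊗[k] A :=
  P.nest a ∘ₗ P.br b + cyc ∘ₗ P.nest b ∘ₗ P.br.flip a +
    cyc ∘ₗ cyc ∘ₗ (LinearMap.rTensorHom A ∘ₗ P.br).flip (P.br a b)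

theorem tripleHom_apply (a b c : A) : P.tripleHom a b c = P.triple a b c := rfl

/- The terms `{{a, c}} ⊗ {{b, d}}` coming from the first two summands cancel, because `c` enters
the first one as `{{a, c}}` and the second one as `{{c, a}}`. -/
theorem isDerivAlong_tripleHom (a b : A) : IsDerivAlong leg1 leg3 (P.tripleHom a b) := by
  intro c d
  have hfirst : P.nested a b (c * d) = P.nested a b c * leg3 d +
      (leg1 c * P.nested a b d + leg12 (P.br a c) * leg23 (P.br b d)) := by
    have h : P.br b (c * d) = P.br b c * inr d + inl c * P.br b d := P.deriv_right b c d
    simp only [nested, h, map_add, nest_mul_inr, nest_inl_mul]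
  have hsecond : P.nested b (c * d) a = leg3 c * P.nested b d a +
      (P.nested b c a * leg2 d + leg13 (P.br c a) * leg12 (P.br b d)) := by
    have h : P.br (c * d) a = inr c * P.br d a + P.br c a * inl d := P.deriv_left c d a
    simp only [nested, h, map_add, nest_inr_mul, nest_mul_inl]
  have hthird : cyc (cyc (P.nested (c * d) a b)) =
      cyc (cyc (P.nested c a b)) * leg3 d + leg1 c * cyc (cyc (P.nested d a b)) := by
    simp only [nested, nest_mul, map_add, cyc_mul, cyc_leg1, cyc_leg2, cyc_leg3]
  have hcancel : leg12 (P.br a c) * leg23 (P.br b d) +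
      leg12 (swap (P.br c a)) * leg23 (P.br b d) = 0 := by
    rw [← add_mul, ← map_add, P.antisymm a c, neg_add_cancel, map_zero, zero_mul]
  simp only [tripleHom_apply, triple, hfirst, hsecond, hthird, map_add, cyc_mul, cyc_leg2,
    cyc_leg3, cyc_leg12, cyc_leg13, add_mul, mul_add, eq_neg_of_add_eq_zero_left hcancel]
  abel

theorem cyc_triple (a b c : A) : cyc (P.triple b c a) = P.triple a b c := by
  simp only [triple, map_add, cyc_cyc_cyc]
  abel

end DoubleBracket

namespace F2S

theorem isQuasiPoisson_of_generators (P : DoubleBracket k (F2S k))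
    (hxxx : P.triple (x k) (x k) (x k) = (4 : k)⁻¹ • distinguished k (x k) (x k) (x k))
    (hyxx : P.triple (y k) (x k) (x k) = (4 : k)⁻¹ • distinguished k (y k) (x k) (x k))
    (hyyx : P.triple (y k) (y k) (x k) = (4 : k)⁻¹ • distinguished k (y k) (y k) (x k))
    (hyyy : P.triple (y k) (y k) (y k) = (4 : k)⁻¹ • distinguished k (y k) (y k) (y k)) :
    P.IsQuasiPoisson := by
  let IsDist (a b c : F2S k) : Prop := P.triple a b c = (4 : k)⁻¹ • distinguished k a b c
  have rotate {a b c} (h : IsDist b c a) : IsDist a b c := by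
    change P.triple a b c = _
    rw [← P.cyc_triple, h, map_smul, cyc_distinguished]
  have extend {a b} (hx : IsDist a b (x k)) (hy : IsDist a b (y k)) (c) : IsDist a b c := by
    simp only [IsDist, distinguished_eq_innerDeriv, ← P.tripleHom_apply,
      ← LinearMap.smul_apply] at hx hy ⊢
    exact DFunLike.congr_fun (deriv_ext (P.isDerivAlong_tripleHom a b)
      ((isDerivAlong_innerDeriv leg1 leg3 _).smul (4 : k)⁻¹) hx hy) c
  have hxx := extend hxxx (rotate (rotate hyxx))
  have hyx := extend hyxx (rotate (rotate hyyx))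
  have hxy := extend (rotate hyxx) (rotate hyyx)
  have hyy := extend hyyx hyyy
  have hx (c) := extend (rotate (rotate (hxx c))) (rotate (rotate (hyx c)))
  have hy (c) := extend (rotate (rotate (hxy c))) (rotate (rotate (hyy c)))
  exact fun a b => extend (rotate (rotate (hx a b))) (rotate (rotate (hy a b)))

end F2S

/-- The right hand side of the defining identity of a multiplicative moment map. -/
def momentRhs (Φ a : A) : A ⊗[k] A := (2 : k)⁻¹ •
  (a ⊗ₜ[k] Φ - (1 : A) ⊗ₜ[k] (Φ * a) + (a * Φ) ⊗ₜ[k] (1 : A) - Φ ⊗ₜ[k] a)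

theorem momentRhs_eq_innerDeriv (Φ a : A) : momentRhs (k := k) Φ a =
    ((2 : k)⁻¹ • innerDeriv inl inr ((1 : A) ⊗ₜ[k] Φ + Φ ⊗ₜ[k] (1 : A))) a := by
  simp only [momentRhs, LinearMap.smul_apply, innerDeriv_apply,
    Algebra.TensorProduct.includeLeft_apply, Algebra.TensorProduct.includeRight_apply,
    mul_add, add_mul, Algebra.TensorProduct.tmul_mul_tmul, mul_one, one_mul]
  congr 1
  abel

theorem F2S.isMomentMap_of_generators (P : DoubleBracket k (F2S k)) {Φ : F2S k} (hΦ : IsUnit Φ)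
    (hx : P.br Φ (x k) = momentRhs Φ (x k)) (hy : P.br Φ (y k) = momentRhs Φ (y k)) :
    P.IsMomentMap Φ := by
  rw [momentRhs_eq_innerDeriv] at hx hy
  refine ⟨hΦ, fun a => Eq.trans ?_ (momentRhs_eq_innerDeriv Φ a).symm⟩
  exact DFunLike.congr_fun (deriv_ext (P.isBiderivAlong.right Φ)
    ((isDerivAlong_innerDeriv inl inr _).smul (2 : k)⁻¹) hx hy) a

end QuasiPoisson

/-! ### Computation of brackets -/

section LocPair

variable {A : Type*} [Ring A]

/-- The units `u` and `v` are `1 + x * y` and `1 + y * x`. -/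
structure IsLocPair (x y : A) (u v : Aˣ) : Prop where
  u_eq : (u : A) = 1 + x * y
  v_eq : (v : A) = 1 + y * x

namespace IsLocPair

variable {x y : A} {u v : Aˣ} (h : IsLocPair x y u v)

include h

theorem symm : IsLocPair y x v u := ⟨h.v_eq, h.u_eq⟩

theorem mul_eq : x * y = u - 1 := by rw [h.u_eq, add_sub_cancel_left]

theorem u_mul : u * x = x * v := by
  rw [h.u_eq, h.v_eq]
  noncomm_ring

theorem u_inv_mul : ↑u⁻¹ * x = x * ↑v⁻¹ := by
  rw [Units.inv_mul_eq_iff_eq_mul, ← mul_assoc, h.u_mul, Units.mul_inv_cancel_right]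

/- Rules moving the units to the right, for words associated to the right. -/
theorem word_rules :
    (x * y = u - 1 ∧ u * x = x * v ∧ ↑u⁻¹ * x = x * ↑v⁻¹) ∧
      ∀ a : A, x * (y * a) = u * a - a ∧ u * (x * a) = x * (v * a) ∧
        ↑u⁻¹ * (x * a) = x * (↑v⁻¹ * a) := by
  refine ⟨⟨h.mul_eq, h.u_mul, h.u_inv_mul⟩, fun a => ⟨?_, ?_, ?_⟩⟩
  · rw [← mul_assoc, h.mul_eq, sub_mul, one_mul]
  · rw [← mul_assoc, h.u_mul, mul_assoc]
  · rw [← mul_assoc, h.u_inv_mul, mul_assoc]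

theorem swap : IsLocPair (-(↑v⁻¹ * y)) x v⁻¹ u⁻¹ where
  u_eq := by
    rw [neg_mul, mul_assoc, h.symm.mul_eq, mul_sub, Units.inv_mul]
    noncomm_ring
  v_eq := by
    rw [mul_neg, ← mul_assoc, ← h.u_inv_mul, mul_assoc, h.mul_eq, mul_sub, Units.inv_mul]
    noncomm_ring

theorem mul_right (w : Aˣ) : IsLocPair (x * w) (↑w⁻¹ * y) u (w⁻¹ * v * w) where
  u_eq := by rw [mul_assoc, Units.mul_inv_cancel_left, h.u_eq]
  v_eq := by
    rw [Units.val_mul, Units.val_mul, h.v_eq, mul_add, add_mul, mul_one, Units.inv_mul]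
    simp only [mul_assoc]

theorem smul {k : Type*} [Field k] [Algebra k A] (β : kˣ) :
    IsLocPair ((β : k)⁻¹ • x) ((β : k) • y) u v where
  u_eq := by rw [smul_mul_smul_comm, inv_mul_cancel₀ β.ne_zero, one_smul, h.u_eq]
  v_eq := by rw [smul_mul_smul_comm, mul_inv_cancel₀ β.ne_zero, one_smul, h.v_eq]

end IsLocPair

end LocPair

section SignedBrackets

variable {k A : Type*} [Field k] [Ring A] [Algebra k A]

namespace DoubleBracket

variable (P : DoubleBracket k A)

theorem br_one_right (a : A) : P.br a 1 = 0 := (P.isBiderivAlong.right a).map_one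

theorem br_one_left (a : A) : P.br 1 a = 0 := (P.isBiderivAlong.left a).map_one

theorem br_inv_right (a : A) (w : Aˣ) :
    P.br a ↑w⁻¹ = -(((↑w⁻¹ : A) ⊗ₜ 1) * (P.br a w * (1 ⊗ₜ (↑w⁻¹ : A)))) := by
  have h := P.deriv_right a ↑w⁻¹ w
  rw [Units.inv_mul, P.br_one_right] at h
  have h' := congrArg (· * ((1 : A) ⊗ₜ[k] (↑w⁻¹ : A))) (eq_neg_of_add_eq_zero_left h.symm)
  simpa [← Algebra.TensorProduct.one_def, mul_assoc] using h'

theorem br_inv_left (w : Aˣ) (a : A) :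
    P.br ↑w⁻¹ a = -((1 ⊗ₜ (↑w⁻¹ : A)) * (P.br w a * ((↑w⁻¹ : A) ⊗ₜ 1))) := by
  simp [P.antisymm _ a, br_inv_right]

end DoubleBracket

theorem IsLocPair.br_right {x y : A} {u v : Aˣ} (h : IsLocPair x y u v) (P : DoubleBracket k A)
    (a : A) : P.br a u = P.br a x * (1 ⊗ₜ y) + (x ⊗ₜ 1) * P.br a y := by
  rw [h.u_eq, map_add, P.br_one_right, zero_add, P.deriv_right]

theorem IsLocPair.br_left {x y : A} {u v : Aˣ} (h : IsLocPair x y u v) (P : DoubleBracket k A)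
    (a : A) : P.br u a = (1 ⊗ₜ x) * P.br y a + P.br x a * (y ⊗ₜ 1) := by
  rw [h.u_eq, map_add, LinearMap.add_apply, P.br_one_left, zero_add, P.deriv_left]

/-- The values of `P` on the pair `(x, y)` are those of the first (`ε = 1`) or of the second
(`ε = -1`) quasi-Hamiltonian structure on the generators. The term `1 ⊗ 1` of `{{y, x}}` is
split into two halves, so that all the formulas are homogeneous in `1 / 2`. -/
structure IsSignedBracket (P : DoubleBracket k A) (ε : k) (x y : A) : Prop where
  br_xx : P.br x x = -(((2 : k)⁻¹ * ε) • ((x ^ 2) ⊗ₜ 1 - 1 ⊗ₜ (x ^ 2)))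
  br_yy : P.br y y = ((2 : k)⁻¹ * ε) • ((y ^ 2) ⊗ₜ 1 - 1 ⊗ₜ (y ^ 2))
  br_yx : P.br y x = (2 : k)⁻¹ •
    ((1 + x * y) ⊗ₜ 1 + 1 ⊗ₜ (1 + y * x) + ε • (x ⊗ₜ y - y ⊗ₜ x))

namespace IsSignedBracket

variable {P : DoubleBracket k A} {ε : k} {x y : A} {u v : Aˣ}

theorem br_xy (h : IsSignedBracket P ε x y) : P.br x y = -((2 : k)⁻¹ •
    (1 ⊗ₜ (1 + x * y) + (1 + y * x) ⊗ₜ 1 + ε • (y ⊗ₜ x - x ⊗ₜ y))) := by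
  simp [P.antisymm x y, h.br_yx]

theorem br_rules (h : IsSignedBracket P ε x y) :
    P.br x x = -(((2 : k)⁻¹ * ε) • ((x ^ 2) ⊗ₜ 1 - 1 ⊗ₜ (x ^ 2))) ∧
    P.br y y = ((2 : k)⁻¹ * ε) • ((y ^ 2) ⊗ₜ 1 - 1 ⊗ₜ (y ^ 2)) ∧
    P.br y x = (2 : k)⁻¹ •
      ((1 + x * y) ⊗ₜ 1 + 1 ⊗ₜ (1 + y * x) + ε • (x ⊗ₜ y - y ⊗ₜ x)) ∧
    P.br x y = -((2 : k)⁻¹ •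
      (1 ⊗ₜ (1 + x * y) + (1 + y * x) ⊗ₜ 1 + ε • (y ⊗ₜ x - x ⊗ₜ y))) :=
  ⟨h.br_xx, h.br_yy, h.br_yx, h.br_xy⟩

attribute [local simp] DoubleBracket.triple DoubleBracket.nested DoubleBracket.br_one_right
  DoubleBracket.br_one_left DoubleBracket.deriv_left DoubleBracket.deriv_right
  DoubleBracket.br_inv_right DoubleBracket.br_inv_left cyc_tmul distinguished momentRhs
  TensorProduct.tmul_add TensorProduct.tmul_sub TensorProduct.add_tmul TensorProduct.sub_tmul
  TensorProduct.neg_tmul TensorProduct.tmul_neg TensorProduct.tmul_smul smul_sub smul_add smul_smul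
  mul_add add_mul mul_sub sub_mul pow_succ mul_assoc

section QuasiPoisson

variable (h : IsSignedBracket P 1 x y)

include h

theorem triple_xxx : P.triple x x x = ((2 : k)⁻¹ * 2⁻¹) • distinguished k x x x := by
  simp [h.br_rules, ← TensorProduct.smul_tmul']
  module

theorem triple_yxx : P.triple y x x = ((2 : k)⁻¹ * 2⁻¹) • distinguished k y x x := by
  simp [h.br_rules, ← TensorProduct.smul_tmul']
  module

set_option maxHeartbeats 400000 in
theorem triple_yyx : P.triple y y x = ((2 : k)⁻¹ * 2⁻¹) • distinguished k y y x := by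
  simp [h.br_rules, ← TensorProduct.smul_tmul']
  module

theorem triple_yyy : P.triple y y y = ((2 : k)⁻¹ * 2⁻¹) • distinguished k y y y := by
  simp [h.br_rules, ← TensorProduct.smul_tmul']
  module

end QuasiPoisson

theorem smul (h : IsSignedBracket P ε x y) (β : kˣ) :
    IsSignedBracket P ε ((β : k)⁻¹ • x) ((β : k) • y) where
  br_xx := by
    simp only [map_smul, LinearMap.smul_apply, h.br_xx, pow_succ, pow_zero, one_mul, smul_sub,
      smul_smul, Algebra.mul_smul_comm, Algebra.smul_mul_assoc, ← TensorProduct.smul_tmul',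
      TensorProduct.tmul_smul, mul_assoc]
    module
  br_yy := by
    simp only [map_smul, LinearMap.smul_apply, h.br_yy, pow_succ, pow_zero, one_mul, smul_sub,
      smul_smul, Algebra.mul_smul_comm, Algebra.smul_mul_assoc, ← TensorProduct.smul_tmul',
      TensorProduct.tmul_smul, mul_assoc]
    module
  br_yx := by simp [h.br_yx, ← TensorProduct.smul_tmul']

section Units

variable (hl : IsLocPair x y u v)

include hl

theorem br_moment_x (h : IsSignedBracket P 1 x y) :
    P.br (v * ↑u⁻¹ : A) x = momentRhs (v * ↑u⁻¹ : A) x := by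
  simp [hl.br_left P, hl.symm.br_left P, h.br_rules, hl.word_rules, hl.symm.word_rules]
  module

theorem br_moment_y (h : IsSignedBracket P 1 x y) :
    P.br (v * ↑u⁻¹ : A) y = momentRhs (v * ↑u⁻¹ : A) y := by
  simp [hl.br_left P, hl.symm.br_left P, h.br_rules, hl.word_rules, hl.symm.word_rules]
  module

theorem swap (h : IsSignedBracket P ε x y) : IsSignedBracket P (-ε) (-(↑v⁻¹ * y)) x where
  br_xx := by
    simp [hl.br_right P, hl.br_left P, h.br_rules, hl.word_rules, hl.symm.word_rules]
    module
  br_yy := by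
    simp only [h.br_rules, pow_succ, pow_zero, one_mul, smul_sub, neg_sub, mul_neg, neg_smul,
      sub_neg_eq_add]
    abel
  br_yx := by
    simp [hl.br_right P, h.br_rules, hl.word_rules, hl.symm.word_rules]
    module

theorem mul_right (h : IsSignedBracket P (-1) x y) : IsSignedBracket P 1 (x * u) (↑u⁻¹ * y) where
  br_xx := by
    simp [hl.br_right P, hl.br_left P, h.br_rules, hl.word_rules, hl.symm.word_rules]
    module
  br_yy := by
    simp [hl.br_right P, hl.br_left P, h.br_rules, hl.word_rules, hl.symm.word_rules]
    module
  br_yx := by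
    simp [hl.br_right P, hl.br_left P, h.br_rules, hl.word_rules, hl.symm.word_rules]
    module

end Units

end IsSignedBracket

end SignedBrackets

/-! ### The two quasi-Hamiltonian structures and their isomorphisms -/

theorem IsSignedBracket.smul_structure {k A : Type*} [Field k] [Ring A] [Algebra k A]
    {H : QuasiHamiltonian k A} {ε : k} {x y : A} (h : IsSignedBracket H.toDoubleBracket ε x y)
    (f : A ≃ₐ[k] A) : IsSignedBracket (f • H).toDoubleBracket ε (f x) (f y) where
  br_xx := by rw [QuasiHamiltonian.smul_br, h.br_xx]; simp
  br_yy := by rw [QuasiHamiltonian.smul_br, h.br_yy]; simp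
  br_yx := by rw [QuasiHamiltonian.smul_br, h.br_yx]; simp

namespace F2S

variable {k : Type*} [Field k]

variable (k) in
theorem isLocPair : IsLocPair (x k) (y k) (u k) (v k) := ⟨u_val k, v_val k⟩

section Lift

variable {C : Type*} [Ring C] [Algebra k C] {a b : C} {s t : Cˣ}

/-- The homomorphism with `x ↦ a`, `y ↦ b`, for `a` and `b` with `1 + a * b` and `1 + b * a`
invertible. -/
def lift (h : IsLocPair a b s t) : F2S k →ₐ[k] C :=
  (exists_algHom a b (h.u_eq ▸ s.isUnit) (h.v_eq ▸ t.isUnit)).choose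

@[simp]
theorem lift_x (h : IsLocPair a b s t) : lift h (x k) = a :=
  (exists_algHom a b (h.u_eq ▸ s.isUnit) (h.v_eq ▸ t.isUnit)).choose_spec.1

@[simp]
theorem lift_y (h : IsLocPair a b s t) : lift h (y k) = b :=
  (exists_algHom a b (h.u_eq ▸ s.isUnit) (h.v_eq ▸ t.isUnit)).choose_spec.2

@[simp]
theorem lift_u (h : IsLocPair a b s t) : lift h (u k : F2S k) = s := by
  rw [u_val, map_add, map_one, map_mul, lift_x, lift_y, h.u_eq]

@[simp]
theorem lift_v (h : IsLocPair a b s t) : lift h (v k : F2S k) = t := by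
  rw [v_val, map_add, map_one, map_mul, lift_x, lift_y, h.v_eq]

@[simp]
theorem lift_u_inv (h : IsLocPair a b s t) : lift h (↑(u k)⁻¹ : F2S k) = ↑s⁻¹ :=
  Units.eq_inv_of_mul_eq_one_right (by rw [← lift_u (k := k) h, ← map_mul, Units.inv_mul, map_one])

@[simp]
theorem lift_v_inv (h : IsLocPair a b s t) : lift h (↑(v k)⁻¹ : F2S k) = ↑t⁻¹ :=
  Units.eq_inv_of_mul_eq_one_right (by rw [← lift_v (k := k) h, ← map_mul, Units.inv_mul, map_one])

end Lift

section Automorphisms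

variable (k) in
/-- The automorphism `ψ : x ↦ x (1 + xy)`, `y ↦ (1 + xy)⁻¹ y`. -/
def psi : F2S k ≃ₐ[k] F2S k :=
  AlgEquiv.ofAlgHom (lift ((isLocPair k).mul_right (u k))) (lift ((isLocPair k).mul_right (u k)⁻¹))
    (algHom_ext (by simp) (by simp)) (algHom_ext (by simp) (by simp))

variable (k) in
/-- The automorphism `ξ : x ↦ -(1 + yx)⁻¹ y`, `y ↦ x`. -/
def xi : F2S k ≃ₐ[k] F2S k :=
  AlgEquiv.ofAlgHom (lift (isLocPair k).swap) (lift (isLocPair k).symm.swap.symm)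
    (algHom_ext (by simp) (by simp)) (algHom_ext (by simp) (by simp))

/-- The automorphism `φ_β : x ↦ β⁻¹ x`, `y ↦ β y`. -/
def phi (β : kˣ) : F2S k ≃ₐ[k] F2S k :=
  AlgEquiv.ofAlgHom (lift ((isLocPair k).smul β)) (lift ((isLocPair k).smul β⁻¹))
    (algHom_ext (by simp [smul_smul]) (by simp [smul_smul]))
    (algHom_ext (by simp [smul_smul]) (by simp [smul_smul]))

variable (k) in
theorem psi_x : psi k (x k) = x k * (u k : F2S k) := lift_x _

variable (k) in
theorem psi_y : psi k (y k) = ((u k)⁻¹ : (F2S k)ˣ) * y k := lift_y _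

variable (k) in
theorem xi_x : xi k (x k) = -(((v k)⁻¹ : (F2S k)ˣ) * y k) := lift_x _

variable (k) in
theorem xi_y : xi k (y k) = x k := lift_y _

theorem phi_x (β : kˣ) : phi β (x k) = (β : k)⁻¹ • x k := lift_x _

theorem phi_y (β : kˣ) : phi β (y k) = (β : k) • y k := lift_y _

end Automorphisms

section Structures

theorem smul_eq_of_isSignedBracket {H H' : QuasiHamiltonian k (F2S k)} {ε : k}
    {f : F2S k ≃ₐ[k] F2S k} (h : IsSignedBracket H.toDoubleBracket ε (x k) (y k))
    (h' : IsSignedBracket H'.toDoubleBracket ε (f (x k)) (f (y k)))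
    (hmoment : f H.moment = H'.moment) : f • H = H' :=
  smul_eq_of_generators (by rw [h.br_xx, h'.br_xx]; simp) (by rw [h.br_yy, h'.br_yy]; simp)
    (by rw [h.br_yx, h'.br_yx]; simp) hmoment

variable (k) in
theorem exists_isSignedBracket (ε : k) :
    ∃ P : DoubleBracket k (F2S k), IsSignedBracket P ε (x k) (y k) := by
  obtain ⟨P, hxx, hyy, hyx⟩ := exists_doubleBracket (k := k)
    (p := -(((2 : k)⁻¹ * ε) • ((x k ^ 2) ⊗ₜ 1 - 1 ⊗ₜ (x k ^ 2))))
    (q := ((2 : k)⁻¹ * ε) • ((y k ^ 2) ⊗ₜ 1 - 1 ⊗ₜ (y k ^ 2)))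
    ((2 : k)⁻¹ • ((1 + x k * y k) ⊗ₜ 1 + 1 ⊗ₜ (1 + y k * x k) + ε • (x k ⊗ₜ y k - y k ⊗ₜ x k)))
    (by simp [smul_sub]) (by simp [smul_sub])
  exact ⟨P, hxx, hyy, hyx⟩

variable (k) in
theorem exists_structure : ∃ H : QuasiHamiltonian k (F2S k),
    IsSignedBracket H.toDoubleBracket 1 (x k) (y k) ∧ H.moment = v k * ((u k)⁻¹ : (F2S k)ˣ) := by
  obtain ⟨P, hP⟩ := exists_isSignedBracket k 1
  have h4 : (4 : k)⁻¹ = 2⁻¹ * 2⁻¹ := by rw [← mul_inv]; norm_num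
  refine ⟨⟨P, isQuasiPoisson_of_generators P ?_ ?_ ?_ ?_, _,
    isMomentMap_of_generators P (v k * (u k)⁻¹ : (F2S k)ˣ).isUnit
      (IsSignedBracket.br_moment_x (isLocPair k) hP)
      (IsSignedBracket.br_moment_y (isLocPair k) hP)⟩, hP, rfl⟩
  exacts [h4 ▸ hP.triple_xxx, h4 ▸ hP.triple_yxx, h4 ▸ hP.triple_yyx, h4 ▸ hP.triple_yyy]

variable (k) in
/-- The first quasi-Hamiltonian structure on `k⟨x, y⟩_S`. -/
def firstStructure : QuasiHamiltonian k (F2S k) := (exists_structure k).choose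

variable (k) in
/-- The second quasi-Hamiltonian structure on `k⟨x, y⟩_S`, as the transport of the first one
by `ξ⁻¹`. -/
def secondStructure : QuasiHamiltonian k (F2S k) := (xi k)⁻¹ • firstStructure k

variable (k) in
theorem isSignedBracket_first :
    IsSignedBracket (firstStructure k).toDoubleBracket 1 (x k) (y k) :=
  (exists_structure k).choose_spec.1

variable (k) in
theorem moment_first : (firstStructure k).moment = v k * ((u k)⁻¹ : (F2S k)ˣ) :=
  (exists_structure k).choose_spec.2

variable (k) in
theorem isSignedBracket_second :
    IsSignedBracket (secondStructure k).toDoubleBracket (-1) (x k) (y k) := by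
  have hx : (xi k)⁻¹ (xi k (x k)) = x k := inv_smul_smul (xi k) (x k)
  have hy : (xi k)⁻¹ (x k) = y k := by rw [← xi_y k]; exact inv_smul_smul (xi k) (y k)
  have h := ((isSignedBracket_first k).swap (isLocPair k)).smul_structure (xi k)⁻¹
  rwa [← xi_x, hx, hy] at h

variable (k) in
theorem moment_second : (secondStructure k).moment = ((u k)⁻¹ : (F2S k)ˣ) * v k := by
  change lift (isLocPair k).symm.swap.symm (firstStructure k).moment = _
  rw [moment_first, map_mul, lift_u_inv, lift_v, inv_inv]

variable (k) in
/-- The set consisting of the two quasi-Hamiltonian structures. -/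
def structures : Set (QuasiHamiltonian k (F2S k)) := {firstStructure k, secondStructure k}

theorem mem_stabilizer_structures {f : F2S k ≃ₐ[k] F2S k}
    (hfirst : f • firstStructure k ∈ structures k)
    (hsecond : f • secondStructure k ∈ structures k) :
    f ∈ MulAction.stabilizer (F2S k ≃ₐ[k] F2S k) (structures k) := by
  have hfinite : (structures k).Finite := Set.toFinite {firstStructure k, secondStructure k}
  rw [MulAction.mem_stabilizer_set_iff_smul_set_subset hfinite]
  rintro _ ⟨H, rfl | rfl, rfl⟩
  exacts [hfirst, hsecond]

theorem xi_smul_second : xi k • secondStructure k = firstStructure k := smul_inv_smul _ _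

theorem xi_smul_first : xi k • firstStructure k = secondStructure k := by
  refine smul_eq_of_isSignedBracket (isSignedBracket_first k) ?_ ?_
  · simpa only [neg_neg, xi_x, xi_y] using (isSignedBracket_second k).swap (isLocPair k)
  · change lift (isLocPair k).swap _ = _
    rw [moment_first, moment_second, map_mul, lift_u_inv, lift_v, inv_inv]

variable (k) in
theorem xi_mem_stabilizer : xi k ∈ MulAction.stabilizer _ (structures k) :=
  mem_stabilizer_structures (Or.inr xi_smul_first) (Or.inl xi_smul_second)

theorem psi_smul_first : psi k • firstStructure k = secondStructure k := by
  refine smul_eq_of_isSignedBracket (isSignedBracket_first k) ?_ ?_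
  · simpa only [psi_x, psi_y] using (isSignedBracket_second k).mul_right (isLocPair k)
  · change lift ((isLocPair k).mul_right (u k)) _ = _
    rw [moment_first, moment_second, map_mul, lift_u_inv, lift_v, ← Units.val_mul,
      mul_inv_cancel_right, Units.val_mul]

theorem phi_smul_first (β : kˣ) : phi β • firstStructure k = firstStructure k := by
  refine smul_eq_of_isSignedBracket (isSignedBracket_first k) ?_ ?_
  · simpa only [phi_x, phi_y] using (isSignedBracket_first k).smul β
  · change lift ((isLocPair k).smul β) _ = _
    rw [moment_first, map_mul, lift_u_inv, lift_v]

theorem phi_smul_second (β : kˣ) : phi β • secondStructure k = secondStructure k := by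
  refine smul_eq_of_isSignedBracket (isSignedBracket_second k) ?_ ?_
  · simpa only [phi_x, phi_y] using (isSignedBracket_second k).smul β
  · change lift ((isLocPair k).smul β) _ = _
    rw [moment_second, map_mul, lift_u_inv, lift_v]

theorem phi_mem_stabilizer (β : kˣ) : phi β ∈ MulAction.stabilizer _ (structures k) :=
  mem_stabilizer_structures (Or.inl (phi_smul_first β)) (Or.inr (phi_smul_second β))

theorem inv_two_smul_add_self {M : Type*} [AddCommGroup M] [Module k M] [NeZero (2 : k)] (m : M) :
    (2 : k)⁻¹ • m + (2 : k)⁻¹ • m = m := by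
  rw [← add_smul, ← two_mul, mul_inv_cancel₀ two_ne_zero, one_smul]

variable (k) in
theorem isFirstStructure_first [NeZero (2 : k)] : IsFirstStructure (firstStructure k) := by
  refine ⟨?_, ?_, ?_, moment_first k⟩
  · rw [(isSignedBracket_first k).br_xx, mul_one]
  · rw [(isSignedBracket_first k).br_yy, mul_one]
  · rw [(isSignedBracket_first k).br_yx, ← inv_two_smul_add_self (k := k) (1 ⊗ₜ 1),
      TensorProduct.add_tmul, TensorProduct.tmul_add]
    module

variable (k) in
theorem isSecondStructure_second [NeZero (2 : k)] : IsSecondStructure (secondStructure k) := by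
  refine ⟨?_, ?_, ?_, moment_second k⟩
  · rw [(isSignedBracket_second k).br_xx, mul_neg_one, neg_smul, neg_neg]
  · rw [(isSignedBracket_second k).br_yy, mul_neg_one, neg_smul]
  · rw [(isSignedBracket_second k).br_yx, ← inv_two_smul_add_self (k := k) (1 ⊗ₜ 1),
      TensorProduct.add_tmul, TensorProduct.tmul_add]
    module

end Structures

end F2S

/-! ### The quotient `B₁ᶜ` -/

section Quotient

variable {k : Type*} [Field k] {c : k}

namespace B1

variable (c) in
/-- The generator `x` of `B₁ᶜ`. -/
def x : B1 c := UnivLoc.of (weylSet c) (QWeyl.mk c (fx k))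

variable (c) in
/-- The generator `y` of `B₁ᶜ`. -/
def y : B1 c := UnivLoc.of (weylSet c) (QWeyl.mk c (fy k))

variable (c) in
/-- The unit `z = 1 + xy` of `B₁ᶜ`. -/
def z : (B1 c)ˣ := UnivLoc.unit (weylSet c) ⟨QWeyl.mk c (1 + fx k * fy k), rfl⟩

variable (c) in
theorem z_eq : (z c : B1 c) = 1 + x c * y c := by
  change UnivLoc.of (weylSet c) (QWeyl.mk c (1 + fx k * fy k)) = _
  simp [x, y]

variable (c) in
theorem z_eq_smul : (z c : B1 c) = c • (1 + y c * x c) := by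
  change UnivLoc.of (weylSet c) (QWeyl.mk c (1 + fx k * fy k)) = _
  rw [QWeyl.mk_rel]
  simp [x, y]

variable {C : Type*} [Ring C] [Algebra k C]

theorem algHom_ext {f g : B1 c →ₐ[k] C} (hx : f (x c) = g (x c)) (hy : f (y c) = g (y c)) :
    f = g := by
  have hfree : (f.comp (UnivLoc.of (weylSet c))).comp (QWeyl.mk c) =
      (g.comp (UnivLoc.of (weylSet c))).comp (QWeyl.mk c) := by
    refine FreeAlgebra.hom_ext (funext fun i => ?_)
    fin_cases i
    exacts [hx, hy]
  refine UnivLoc.algHom_ext (AlgHom.ext fun a => ?_)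
  obtain ⟨a, rfl⟩ := RingQuot.mkAlgHom_surjective k (QWeylRel c) a
  exact DFunLike.congr_fun hfree a

theorem exists_algHom {a b : C} (hab : IsUnit (1 + a * b)) (h : 1 + a * b = c • (1 + b * a)) :
    ∃ f : B1 c →ₐ[k] C, f (x c) = a ∧ f (y c) = b := by
  let g : FreeAlgebra k (Fin 2) →ₐ[k] C := FreeAlgebra.lift k ![a, b]
  have hgx : g (fx k) = a := by simp [g, fx]
  have hgy : g (fy k) = b := by simp [g, fy]
  let g' : QWeyl c →ₐ[k] C := RingQuot.liftAlgHom k (s := QWeylRel c) ⟨g, by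
    rintro _ _ ⟨⟩
    simpa only [map_add, map_one, map_mul, map_smul, hgx, hgy] using h⟩
  have hg' (p) : g' (QWeyl.mk c p) = g p := RingQuot.liftAlgHom_mkAlgHom_apply k g _ p
  refine ⟨UnivLoc.lift g' ?_, ?_, ?_⟩
  · rintro ⟨_, rfl⟩
    simpa only [hg', map_add, map_one, map_mul, hgx, hgy] using hab
  · rw [x, UnivLoc.lift_of, hg', hgx]
  · rw [y, UnivLoc.lift_of, hg', hgy]

theorem eq_top_of_mem (S : Subalgebra k (B1 c)) (hx : x c ∈ S) (hy : y c ∈ S)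
    (hz : (((z c)⁻¹ : (B1 c)ˣ) : B1 c) ∈ S) : S = ⊤ := by
  let a : S := ⟨x c, hx⟩
  let b : S := ⟨y c, hy⟩
  have hab : ((1 + a * b : S) : B1 c) = z c := (z_eq c).symm
  have hunit : IsUnit (1 + a * b) := isUnit_iff_exists.mpr
    ⟨⟨_, hz⟩, Subtype.ext (by rw [MulMemClass.coe_mul, hab, Units.mul_inv, OneMemClass.coe_one]),
      Subtype.ext (by rw [MulMemClass.coe_mul, hab, Units.inv_mul, OneMemClass.coe_one])⟩
  obtain ⟨f, hfx, hfy⟩ := exists_algHom (c := c) hunit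
    (Subtype.ext ((z_eq c).symm.trans (z_eq_smul c)))
  have hf : S.val.comp f = AlgHom.id k (B1 c) :=
    algHom_ext (congrArg S.val hfx) (congrArg S.val hfy)
  refine eq_top_iff.mpr fun p _ => ?_
  rw [← AlgHom.id_apply (R := k) p, ← hf]
  exact (f p).2

end B1

variable (hc : c ≠ 0)

theorem toB1_x : toB1 hc (F2S.x k) = B1.x c := UnivLoc.lift_of _ _ _

theorem toB1_y : toB1 hc (F2S.y k) = B1.y c := UnivLoc.lift_of _ _ _

theorem toB1_u : toB1 hc (F2S.u k : F2S k) = B1.z c := by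
  rw [F2S.u_val, B1.z_eq, map_add, map_mul, toB1_x, toB1_y, map_one]

theorem toB1_u_inv : toB1 hc (↑(F2S.u k)⁻¹ : F2S k) = ↑(B1.z c)⁻¹ :=
  Units.eq_inv_of_mul_eq_one_right (by rw [← toB1_u hc, ← map_mul, Units.inv_mul, map_one])

theorem toB1_u_eq_smul : toB1 hc (F2S.u k : F2S k) = c • toB1 hc (F2S.v k : F2S k) := by
  rw [toB1_u, B1.z_eq_smul, F2S.v_val, map_add, map_mul, toB1_x, toB1_y, map_one]

theorem toB1_v_inv : toB1 hc (↑(F2S.v k)⁻¹ : F2S k) = c • (↑(B1.z c)⁻¹ : B1 c) := by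
  refine (Units.eq_inv_of_mul_eq_one_left (u := Units.map (toB1 hc : F2S k →* B1 c) (F2S.v k))
    ?_).symm
  rw [mul_smul_comm, ← smul_mul_assoc]
  exact (toB1_u_eq_smul hc ▸ toB1_u hc) ▸ (B1.z c).mul_inv

theorem toB1_surjective : Function.Surjective (toB1 hc) := by
  rw [← AlgHom.range_eq_top]
  exact B1.eq_top_of_mem _ ⟨_, toB1_x hc⟩ ⟨_, toB1_y hc⟩ ⟨_, toB1_u_inv hc⟩

theorem exists_comp_toB1_eq {C : Type*} [Ring C] [Algebra k C] {g : F2S k →ₐ[k] C}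
    (hg : g (F2S.u k : F2S k) = c • g (F2S.v k : F2S k)) :
    ∃ f : B1 c →ₐ[k] C, f.comp (toB1 hc) = g := by
  rw [F2S.u_val, F2S.v_val] at hg
  simp only [map_add, map_mul, map_one] at hg
  obtain ⟨f, hfx, hfy⟩ := B1.exists_algHom (F2S.isUnit_one_add_map_mul_map g) hg
  refine ⟨f, F2S.algHom_ext ?_ ?_⟩
  · rw [AlgHom.comp_apply, toB1_x, hfx]
  · rw [AlgHom.comp_apply, toB1_y, hfy]

theorem map_moment_eq_iff (hc : c ≠ 0) {H : QuasiHamiltonian k (F2S k)}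
    (hH : H ∈ F2S.structures k) {C : Type*} [Ring C] [Algebra k C] (g : F2S k →ₐ[k] C) :
    g H.moment = algebraMap k C c⁻¹ ↔ g (F2S.u k : F2S k) = c • g (F2S.v k : F2S k) := by
  have hU : g ↑(F2S.u k)⁻¹ = ↑(Units.map (g : F2S k →* C) (F2S.u k))⁻¹ := rfl
  rw [Algebra.algebraMap_eq_smul_one, eq_inv_smul_iff₀ hc, eq_comm (a := g (F2S.u k : F2S k))]
  rcases hH with rfl | rfl
  · rw [F2S.moment_first, map_mul, hU, ← smul_mul_assoc, Units.mul_inv_eq_one]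
    rfl
  · rw [F2S.moment_second, map_mul, hU, ← mul_smul_comm, Units.inv_mul_eq_one, eq_comm]
    rfl

theorem toB1_moment {H : QuasiHamiltonian k (F2S k)} (hH : H ∈ F2S.structures k) :
    toB1 hc H.moment = algebraMap k (B1 c) c⁻¹ :=
  (map_moment_eq_iff hc hH _).2 (toB1_u_eq_smul hc)

theorem ker_toB1 {H : QuasiHamiltonian k (F2S k)} (hH : H ∈ F2S.structures k) :
    TwoSidedIdeal.ker (toB1 hc) =
      TwoSidedIdeal.span {H.moment - algebraMap k (F2S k) c⁻¹} := by
  set I := TwoSidedIdeal.span {H.moment - algebraMap k (F2S k) c⁻¹}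
  refine le_antisymm (fun p hp => ?_) ?_
  · let π := I.ringCon.mkₐ (α := k)
    have hπ (a b : F2S k) : π a = π b ↔ a - b ∈ I := (RingCon.eq _).trans (I.rel_iff a b)
    have hmoment : π H.moment = algebraMap k _ c⁻¹ := by
      rw [← AlgHom.commutes π, hπ]
      exact TwoSidedIdeal.subset_span rfl
    obtain ⟨f, hf⟩ := exists_comp_toB1_eq hc ((map_moment_eq_iff hc hH π).1 hmoment)
    have h0 : π p = π 0 := by
      rw [← hf, AlgHom.comp_apply, (TwoSidedIdeal.mem_ker _).1 hp, map_zero, map_zero]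
    rwa [hπ, sub_zero] at h0
  · rw [TwoSidedIdeal.span_le, Set.singleton_subset_iff, SetLike.mem_coe, TwoSidedIdeal.mem_ker,
      map_sub, toB1_moment hc hH, AlgHom.commutes, sub_self]

variable {hc}

theorem exists_induces {H : QuasiHamiltonian k (F2S k)} {f : F2S k ≃ₐ[k] F2S k}
    (hH : H ∈ F2S.structures k) (hfH : f • H ∈ F2S.structures k) : ∃ σ, Induces hc f σ := by
  have hdescent {H : QuasiHamiltonian k (F2S k)} {f : F2S k ≃ₐ[k] F2S k}
      (hH : H ∈ F2S.structures k) (hfH : f • H ∈ F2S.structures k) :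
      ∃ s : B1 c →ₐ[k] B1 c, s.comp (toB1 hc) = (toB1 hc).comp (f : F2S k →ₐ[k] F2S k) :=
    exists_comp_toB1_eq hc ((map_moment_eq_iff hc hH _).1 (toB1_moment hc hfH))
  obtain ⟨s, hs⟩ := hdescent hH hfH
  obtain ⟨t, ht⟩ := hdescent (f := f⁻¹) hfH ((inv_smul_smul f H).symm ▸ hH)
  replace hs (p) : s (toB1 hc p) = toB1 hc (f p) := DFunLike.congr_fun hs p
  replace ht (p) : t (toB1 hc p) = toB1 hc (f.symm p) := DFunLike.congr_fun ht p
  refine ⟨AlgEquiv.ofAlgHom s t (AlgHom.ext fun b => ?_) (AlgHom.ext fun b => ?_), hs⟩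
  · obtain ⟨p, rfl⟩ := toB1_surjective hc b
    simp only [AlgHom.comp_apply, ht, hs, AlgEquiv.apply_symm_apply, AlgHom.id_apply]
  · obtain ⟨p, rfl⟩ := toB1_surjective hc b
    simp only [AlgHom.comp_apply, ht, hs, AlgEquiv.symm_apply_apply, AlgHom.id_apply]

namespace Induces

variable {f g : F2S k ≃ₐ[k] F2S k} {σ τ : B1 c ≃ₐ[k] B1 c}

protected theorem one : Induces hc 1 1 := fun _ => rfl

protected theorem mul (hf : Induces hc f σ) (hg : Induces hc g τ) : Induces hc (f * g) (σ * τ) :=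
  fun p => by rw [AlgEquiv.mul_apply, AlgEquiv.mul_apply, hg, hf]

protected theorem inv (hf : Induces hc f σ) : Induces hc f⁻¹ σ⁻¹ := fun p => by
  obtain ⟨q, rfl⟩ := f.surjective p
  rw [← hf]
  exact (inv_smul_smul σ (toB1 hc q)).trans (congrArg _ (inv_smul_smul f q).symm)

end Induces

end Quotient

/-! ### Skew monoid algebras and Laurent polynomials -/

section SkewMonoidAlgebra

open SkewMonoidAlgebra

variable {R G : Type*} [Semiring R]

theorem coeff_mul_mul_of_uniqueMul [Mul G] [SMulZeroClass G R] {p q : SkewMonoidAlgebra R G}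
    {g h : G} (hgh : UniqueMul p.support q.support g h) :
    (p * q).coeff (g * h) = p.coeff g * g • q.coeff h := by
  classical
  simp_rw [coeff_mul, SkewMonoidAlgebra.sum_def, Finsupp.sum, ← Finset.sum_product']
  refine (Finset.sum_eq_single (g, h) (fun s hs hne => if_neg fun heq => hne ?_)
    fun hnotMem => ?_).trans (if_pos rfl)
  · rw [Finset.mem_product] at hs
    exact Prod.ext_iff.2 (hgh hs.1 hs.2 heq)
  · rw [if_pos rfl]
    rcases not_and_or.1 (mt Finset.mem_product.2 hnotMem) with hp | hq
    · rw [Finsupp.notMem_support_iff.1 hp, zero_mul]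
    · rw [Finsupp.notMem_support_iff.1 hq, smul_zero, mul_zero]

theorem exists_eq_single_of_card_support_eq_one {p : SkewMonoidAlgebra R G}
    (hp : p.support.card = 1) : ∃ g r, p = single g r := by
  obtain ⟨g, -, hg⟩ := Finsupp.card_support_eq_one.1 hp
  exact ⟨g, p.coeff g, coeff_injective hg⟩

theorem exists_eq_single_of_mul_eq_single [NoZeroDivisors R] [Group G] [TwoUniqueProds G]
    [MulSemiringAction G R] {p q : SkewMonoidAlgebra R G} {g : G} {r : R} (hr : r ≠ 0)
    (hpq : p * q = single g r) :
    ∃ h h' s t, p = single h s ∧ q = single h' t ∧ h * h' = g ∧ s * h • t = r := by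
  classical
  have hne : p * q ≠ 0 := by rwa [hpq, Ne, single_eq_zero]
  have hp : 0 < p.support.card :=
    Finset.card_pos.2 (Finset.nonempty_iff_ne_empty.2
      (mt support_eq_empty.1 (left_ne_zero_of_mul hne)))
  have hq : 0 < q.support.card :=
    Finset.card_pos.2 (Finset.nonempty_iff_ne_empty.2
      (mt support_eq_empty.1 (right_ne_zero_of_mul hne)))
  have hcard : p.support.card * q.support.card ≤ 1 := by
    by_contra! hcard
    obtain ⟨s, hs, t, ht, hst, hsu, htu⟩ := TwoUniqueProds.uniqueMul_of_one_lt_card hcard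
    have hdeg {s : G × G} (hs : s ∈ p.support ×ˢ q.support)
        (hsu : UniqueMul p.support q.support s.1 s.2) : s.1 * s.2 = g := by
      obtain ⟨hsp, hsq⟩ := Finset.mem_product.1 hs
      by_contra hsg
      refine mul_ne_zero (mem_support_iff.1 hsp)
        ((smul_ne_zero_iff_ne s.1).2 (mem_support_iff.1 hsq)) ?_
      rw [← coeff_mul_mul_of_uniqueMul hsu, hpq, coeff_single_apply, if_neg (Ne.symm hsg)]
    obtain ⟨htp, htq⟩ := Finset.mem_product.1 ht
    exact hst (Prod.ext_iff.2 (hsu htp htq ((hdeg ht htu).trans (hdeg hs hsu).symm))).symm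
  obtain ⟨h, s, rfl⟩ := exists_eq_single_of_card_support_eq_one (p := p) (by nlinarith)
  obtain ⟨h', t, rfl⟩ := exists_eq_single_of_card_support_eq_one (p := q) (by nlinarith)
  rw [single_mul_single] at hpq hne
  rw [Ne, single_eq_zero] at hne
  rw [← coeff_inj, coeff_single, coeff_single, Finsupp.single_eq_single_iff] at hpq
  obtain ⟨hg, hr⟩ := hpq.resolve_right fun h => hne h.1
  exact ⟨h, h', s, t, rfl, rfl, hg, hr⟩

end SkewMonoidAlgebra

section Laurent

open LaurentPolynomial

variable {k : Type*} [Field k] {A : Type*} [Ring A] [Algebra k A]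

/-- Evaluation of Laurent polynomials at a unit of a not necessarily commutative algebra. -/
def laurentEval (w : Aˣ) : k[T;T⁻¹] →ₐ[k] A :=
  AddMonoidAlgebra.lift k A ℤ ((Units.coeHom A).comp (zpowersHom Aˣ w))

theorem laurentEval_T (w : Aˣ) (n : ℤ) : laurentEval w (T n : k[T;T⁻¹]) = ↑(w ^ n) := by
  rw [laurentEval, T, AddMonoidAlgebra.lift_single, one_smul]
  rfl

theorem laurentEval_T_one (w : Aˣ) : laurentEval w (T 1 : k[T;T⁻¹]) = w := by
  rw [laurentEval_T, zpow_one]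

theorem laurent_algHom_ext {f g : k[T;T⁻¹] →ₐ[k] A} (h : f (T 1) = g (T 1)) : f = g := by
  refine AddMonoidAlgebra.algHom_ext' (MonoidHom.ext_mint ?_) (Subsingleton.elim _ _)
  exact h

theorem units_smul_zpow (r : kˣ) (w : Aˣ) (n : ℤ) : (r • w) ^ n = r ^ n • w ^ n := by
  have : SMulCommClass kˣ Aˣ Aˣ := ⟨fun r a b => Units.ext (mul_smul_comm r (a : A) b).symm⟩
  have : IsScalarTower kˣ Aˣ Aˣ := ⟨fun r a b => Units.ext (smul_mul_assoc r (a : A) b)⟩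
  exact smul_zpow r w n

theorem map_laurentEval {B : Type*} [Ring B] [Algebra k B] {φ : A →ₐ[k] B} {w : Aˣ} {w' : Bˣ}
    (h : φ w = w') (f : k[T;T⁻¹]) : φ (laurentEval w f) = laurentEval w' f := by
  refine DFunLike.congr_fun (laurent_algHom_ext (f := φ.comp (laurentEval w)) ?_) f
  rw [AlgHom.comp_apply, laurentEval_T_one, laurentEval_T_one, h]

theorem eq_of_smul_T_eq_smul_T {r s : kˣ} {m n : ℤ}
    (h : (r : k) • (T m : k[T;T⁻¹]) = (s : k) • T n) : m = n := by
  have hdeg := congrArg LaurentPolynomial.degree h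
  rw [smul_eq_C_mul, smul_eq_C_mul, degree_C_mul_T _ _ r.ne_zero, degree_C_mul_T _ _ s.ne_zero]
    at hdeg
  exact WithBot.coe_injective hdeg

theorem smul_T_one_sub_one_ne_zero (r : kˣ) : (r : k) • (T 1 : k[T;T⁻¹]) - 1 ≠ 0 := fun h =>
  one_ne_zero (eq_of_smul_T_eq_smul_T (s := 1) ((sub_eq_zero.1 h).trans (one_smul k _).symm))

theorem exists_eq_smul_T_of_isUnit {f : k[T;T⁻¹]} (hf : IsUnit f) :
    ∃ (r : kˣ) (n : ℤ), f = (r : k) • T n := by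
  obtain ⟨g, hfg⟩ := hf.exists_right_inv
  obtain ⟨m, p, hp⟩ := exists_T_pow f
  obtain ⟨n, q, hq⟩ := exists_T_pow g
  have hpq : p * q = Polynomial.X ^ (m + n) := by
    apply Polynomial.toLaurent_injective
    rw [map_mul, hp, hq, mul_mul_mul_comm, hfg, one_mul, ← T_add, Polynomial.toLaurent_X_pow,
      Nat.cast_add]
  obtain ⟨i, -, w, hw⟩ := (dvd_prime_pow Polynomial.prime_X (m + n)).1 ⟨q, hpq.symm⟩
  obtain ⟨r, hr, hrw⟩ := Polynomial.isUnit_iff.1 (Units.isUnit w⁻¹)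
  have hpX : p = Polynomial.C r * Polynomial.X ^ i := by
    rw [hrw, ← hw, mul_comm, mul_assoc, Units.mul_inv, mul_one]
  refine ⟨hr.unit, i - m, ?_⟩
  rw [T_sub, ← smul_mul_assoc, IsUnit.unit_spec, smul_eq_C_mul,
    ← Polynomial.toLaurent_C_mul_X_pow, ← hpX, hp, mul_assoc, ← T_add, add_neg_cancel,
    T_zero, mul_one]

end Laurent

/-! ### The quantum torus -/

section Twist

open LaurentPolynomial

variable {k : Type*} [Field k] {A : Type*} [Ring A] [Algebra k A]

/-- The action of `kˣ` on Laurent polynomials by the substitutions `T ↦ r T`. -/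
def twist : kˣ →* (k[T;T⁻¹] ≃ₐ[k] k[T;T⁻¹]) :=
  (AlgEquiv.algHomUnitsEquiv k k[T;T⁻¹]).toMonoidHom.comp <| MonoidHom.toHomUnits
    { toFun := fun r => laurentEval (r • (isUnit_T 1).unit)
      map_one' := laurent_algHom_ext (by simp [laurentEval_T_one])
      map_mul' := fun r s => laurent_algHom_ext (by
        rw [AlgHom.mul_apply, laurentEval_T_one, laurentEval_T_one, Units.val_smul, Units.val_smul,
          IsUnit.unit_spec, Units.smul_def, Units.smul_def, map_smul, laurentEval_T_one,
          Units.val_smul, IsUnit.unit_spec, Units.smul_def, Units.val_mul, smul_smul,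
          mul_comm (r : k)]) }

theorem twist_T_one (r : kˣ) : twist r (T 1 : k[T;T⁻¹]) = (r : k) • T 1 :=
  laurentEval_T_one _

theorem laurentEval_twist (w : Aˣ) (r : kˣ) (f : k[T;T⁻¹]) :
    laurentEval w (twist r f) = laurentEval (r • w) f := by
  refine map_laurentEval ?_ f
  rw [Units.val_smul, IsUnit.unit_spec, Units.smul_def, map_smul, laurentEval_T_one,
    Units.val_smul, Units.smul_def]

theorem semiconjBy_laurentEval {a : A} {w w' : Aˣ} (h : SemiconjBy a w w') (f : k[T;T⁻¹]) :
    SemiconjBy a (laurentEval w f) (laurentEval w' f) := by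
  induction f using LaurentPolynomial.induction_on' with
  | add f g hf hg =>
    rw [map_add, map_add]
    exact hf.add_right hg
  | C_mul_T n r =>
    rw [← smul_eq_C_mul, map_smul, map_smul, laurentEval_T, laurentEval_T]
    exact (h.units_zpow_right n).smul_right r

theorem exists_pow_mul_pow_eq_laurentEval {a b : A} {w : Aˣ} {r : kˣ} {e : k[T;T⁻¹]}
    (ha : SemiconjBy a w ↑(r • w)) (hab : a * b = laurentEval w e) (n : ℕ) :
    ∃ f : k[T;T⁻¹], a ^ (n + 1) * b ^ (n + 1) = laurentEval w (f * e) := by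
  induction n with
  | zero => exact ⟨1, by rw [zero_add, pow_one, pow_one, one_mul, hab]⟩
  | succ n ih =>
    obtain ⟨f, hf⟩ := ih
    refine ⟨twist r (f * e), ?_⟩
    rw [pow_succ' a, pow_succ b, mul_assoc, ← mul_assoc _ _ b, hf, ← mul_assoc,
      (semiconjBy_laurentEval ha _).eq, ← laurentEval_twist, mul_assoc, hab, ← map_mul]

/-- `k[T;T⁻¹]` with the action of `ℤ` in which `n` acts by `T ↦ qⁿ T`. -/
def TwistedLaurent (_q : kˣ) : Type _ := k[T;T⁻¹]

namespace TwistedLaurent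

variable (q : kˣ)

instance : CommRing (TwistedLaurent q) := inferInstanceAs (CommRing k[T;T⁻¹])

instance : NoZeroDivisors (TwistedLaurent q) := inferInstanceAs (NoZeroDivisors k[T;T⁻¹])

instance : Algebra k (TwistedLaurent q) := inferInstanceAs (Algebra k k[T;T⁻¹])

/-- The identity map into the type synonym. -/
def of : k[T;T⁻¹] ≃ₐ[k] TwistedLaurent q := AlgEquiv.refl

instance : MulSemiringAction (Multiplicative ℤ) (TwistedLaurent q) :=
  MulSemiringAction.compHom k[T;T⁻¹] (twist.comp (zpowersHom kˣ q))

instance : SMulCommClass (Multiplicative ℤ) k (TwistedLaurent q) :=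
  ⟨fun n r f => map_smul (twist (zpowersHom kˣ q n)) r f⟩

end TwistedLaurent

/-- The quantum torus `k⟨X^±, T^±⟩ / (X T - q T X)`, as a skew group algebra of `ℤ`. -/
abbrev QuantumTorus (q : kˣ) : Type _ := SkewMonoidAlgebra (TwistedLaurent q) (Multiplicative ℤ)

namespace QuantumTorus

variable (q : kˣ)

/-- The monomial `f Xⁿ` of the quantum torus. -/
def monomial (n : ℤ) (f : k[T;T⁻¹]) : QuantumTorus q :=
  .single (Multiplicative.ofAdd n) (TwistedLaurent.of q f)

theorem monomial_mul_monomial (m n : ℤ) (f g : k[T;T⁻¹]) :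
    monomial q m f * monomial q n g = monomial q (m + n) (f * twist (q ^ m) g) :=
  SkewMonoidAlgebra.single_mul_single

/-- The coefficients of `X⁰` in the quantum torus. -/
def degreeZero : k[T;T⁻¹] →ₐ[k] QuantumTorus q where
  toRingHom := SkewMonoidAlgebra.singleOneRingHom.comp (TwistedLaurent.of q : k[T;T⁻¹] →+* _)
  commutes' _ := rfl

theorem degreeZero_apply (f : k[T;T⁻¹]) : degreeZero q f = monomial q 0 f := rfl

theorem coeff_monomial_self (n : ℤ) (f : k[T;T⁻¹]) :
    (monomial q n f).coeff (.ofAdd n) = TwistedLaurent.of q f :=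
  Finsupp.single_eq_same

theorem coeff_monomial_of_ne {m n : ℤ} (h : m ≠ n) (f : k[T;T⁻¹]) :
    (monomial q n f).coeff (.ofAdd m) = 0 :=
  Finsupp.single_eq_of_ne (Multiplicative.ofAdd.injective.ne h)

theorem monomial_zero (n : ℤ) : monomial q n 0 = 0 := SkewMonoidAlgebra.single_zero _

theorem monomial_injective (n : ℤ) : Function.Injective (monomial q n) :=
  (SkewMonoidAlgebra.single_injective _).comp (TwistedLaurent.of q).injective

theorem exists_monomial_pow (n : ℤ) {f : k[T;T⁻¹]} (hf : f ≠ 0) (m : ℕ) :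
    ∃ g ≠ 0, monomial q n f ^ m = monomial q (m * n) g := by
  induction m with
  | zero => exact ⟨1, one_ne_zero, by rw [pow_zero, Nat.cast_zero, zero_mul]; rfl⟩
  | succ m ih =>
    obtain ⟨g, hg, h⟩ := ih
    refine ⟨_, mul_ne_zero hg ((map_ne_zero_iff _ (twist (q ^ (m * n))).injective).2 hf), ?_⟩
    rw [pow_succ, h, monomial_mul_monomial, Nat.cast_succ, add_one_mul]

end QuantumTorus

end Twist

/-! ### The structure of `B₁ᶜ` -/

section Structure

open LaurentPolynomial QuantumTorus

variable {k : Type*} [Field k] {A : Type*} [Ring A] [Algebra k A]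

theorem semiconjBy_pow {a : A} {w : Aˣ} {r : kˣ} (h : SemiconjBy a w ↑(r • w)) (n : ℕ) :
    SemiconjBy (a ^ n) w ↑(r ^ n • w) := by
  induction n with
  | zero => simp only [pow_zero, one_smul, SemiconjBy.one_left]
  | succ n ih =>
    rw [pow_succ', pow_succ, mul_smul, Units.val_smul]
    exact (h.smul_right (r ^ n)).mul_left ih

variable (q : kˣ)

namespace B1

/-- The Laurent polynomials in `z = 1 + xy`, as elements of `B₁^q`. -/
abbrev ofLaurent : k[T;T⁻¹] →ₐ[k] B1 (q : k) := laurentEval (z (q : k))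

theorem x_mul_y : x (q : k) * y (q : k) = ofLaurent q (T 1 - 1) := by
  rw [map_sub, map_one, laurentEval_T_one, z_eq, add_sub_cancel_left]

theorem y_mul_x : y (q : k) * x (q : k) = ofLaurent q ((q⁻¹ : k) • T 1 - 1) := by
  rw [map_sub, map_smul, map_one, laurentEval_T_one, z_eq_smul, inv_smul_smul₀ q.ne_zero,
    add_sub_cancel_left]

theorem semiconjBy_x_z : SemiconjBy (x (q : k)) (z (q : k)) ↑(q • z (q : k)) := by
  rw [SemiconjBy, Units.val_smul, smul_mul_assoc]
  nth_rw 1 [z_eq_smul]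
  rw [z_eq, mul_smul_comm, Units.smul_def]
  noncomm_ring

theorem semiconjBy_y_z : SemiconjBy (y (q : k)) (z (q : k)) ↑(q⁻¹ • z (q : k)) := by
  rw [SemiconjBy, Units.val_smul, smul_mul_assoc, eq_inv_smul_iff]
  nth_rw 2 [z_eq_smul]
  rw [z_eq, smul_mul_assoc, Units.smul_def]
  noncomm_ring

theorem exists_toTorus : ∃ f : B1 (q : k) →ₐ[k] QuantumTorus q,
    f (x (q : k)) = monomial q 1 1 ∧ f (y (q : k)) = monomial q (-1) ((q⁻¹ : k) • T 1 - 1) := by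
  have hXY : 1 + monomial q 1 1 * monomial q (-1) ((q⁻¹ : k) • T 1 - 1) = degreeZero q (T 1) := by
    rw [monomial_mul_monomial, zpow_one, one_mul, map_sub, map_smul, twist_T_one, map_one,
      inv_smul_smul₀ q.ne_zero, add_neg_cancel, ← degreeZero_apply, map_sub, map_one,
      add_sub_cancel]
  have hYX : 1 + monomial q (-1) ((q⁻¹ : k) • T 1 - 1) * monomial q 1 1 =
      degreeZero q ((q⁻¹ : k) • T 1) := by
    rw [monomial_mul_monomial, map_one, mul_one, neg_add_cancel, ← degreeZero_apply, map_sub,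
      map_one, add_sub_cancel]
  refine exists_algHom (hXY ▸ (isUnit_T 1).map _) ?_
  rw [hXY, hYX, map_smul, smul_inv_smul₀ q.ne_zero]

/-- The embedding of `B₁^q` into the quantum torus with `x ↦ X` and `z ↦ T`. -/
def toTorus : B1 (q : k) →ₐ[k] QuantumTorus q := (exists_toTorus q).choose

theorem toTorus_x : toTorus q (x (q : k)) = monomial q 1 1 := (exists_toTorus q).choose_spec.1

theorem toTorus_y : toTorus q (y (q : k)) = monomial q (-1) ((q⁻¹ : k) • T 1 - 1) :=
  (exists_toTorus q).choose_spec.2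

theorem toTorus_ofLaurent (f : k[T;T⁻¹]) : toTorus q (ofLaurent q f) = monomial q 0 f := by
  refine DFunLike.congr_fun
    (laurent_algHom_ext (f := (toTorus q).comp (ofLaurent q)) (g := degreeZero q) ?_) f
  rw [AlgHom.comp_apply, laurentEval_T_one, z_eq, map_add, map_mul, map_one, toTorus_x, toTorus_y,
    monomial_mul_monomial, zpow_one, one_mul, map_sub, map_smul, twist_T_one, map_one,
    inv_smul_smul₀ q.ne_zero, add_neg_cancel, ← degreeZero_apply, map_sub, map_one,
    add_sub_cancel]

theorem ofLaurent_injective : Function.Injective (ofLaurent q) := fun f g h =>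
  monomial_injective q 0 (by rw [← toTorus_ofLaurent, h, toTorus_ofLaurent])

/-- The homogeneous element `xⁱ` or `y⁻ⁱ` of `B₁^q`, whose degree is `i`. -/
def mono (i : ℤ) : B1 (q : k) := x (q : k) ^ i.toNat * y (q : k) ^ (-i).toNat

theorem mono_zero : mono q 0 = 1 := by
  rw [mono, neg_zero, Int.toNat_zero, pow_zero, pow_zero, mul_one]

theorem mono_natCast (n : ℕ) : mono q n = x (q : k) ^ n := by simp [mono]

theorem mono_neg_natCast (n : ℕ) : mono q (-n) = y (q : k) ^ n := by simp [mono]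

theorem mono_one : mono q 1 = x (q : k) := (mono_natCast q 1).trans (pow_one _)

theorem mono_neg_one : mono q (-1) = y (q : k) := (mono_neg_natCast q 1).trans (pow_one _)

theorem mono_mul_ofLaurent (i : ℤ) (f : k[T;T⁻¹]) :
    mono q i * ofLaurent q f = ofLaurent q (twist (q ^ i) f) * mono q i := by
  have hmono : SemiconjBy (mono q i) (z (q : k)) ↑(q ^ i • z (q : k)) := by
    obtain ⟨n, rfl | rfl⟩ := i.eq_nat_or_neg
    · rw [mono_natCast, zpow_natCast]
      exact semiconjBy_pow (semiconjBy_x_z q) n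
    · rw [mono_neg_natCast, zpow_neg, zpow_natCast, ← inv_pow]
      exact semiconjBy_pow (semiconjBy_y_z q) n
  rw [laurentEval_twist]
  exact semiconjBy_laurentEval hmono f

theorem exists_x_mul_mono (i : ℤ) : ∃ e, x (q : k) * mono q i = ofLaurent q e * mono q (i + 1) := by
  obtain ⟨n, rfl | rfl⟩ := i.eq_nat_or_neg
  · refine ⟨1, ?_⟩
    rw [map_one, one_mul, mono_natCast, ← Nat.cast_succ, mono_natCast, pow_succ']
  · cases n with
    | zero => exact ⟨1, by simp [mono]⟩
    | succ n =>
      refine ⟨T 1 - 1, ?_⟩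
      rw [show -((n + 1 : ℕ) : ℤ) + 1 = -n by push_cast; ring, mono_neg_natCast, mono_neg_natCast,
        pow_succ', ← mul_assoc, x_mul_y]

theorem exists_y_mul_mono (i : ℤ) : ∃ e, y (q : k) * mono q i = ofLaurent q e * mono q (i - 1) := by
  obtain ⟨n, rfl | rfl⟩ := i.eq_nat_or_neg
  · cases n with
    | zero => exact ⟨1, by simp [mono]⟩
    | succ n =>
      refine ⟨(q⁻¹ : k) • T 1 - 1, ?_⟩
      rw [show ((n + 1 : ℕ) : ℤ) - 1 = n by push_cast; ring, mono_natCast, mono_natCast,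
        pow_succ', ← mul_assoc, y_mul_x]
  · refine ⟨1, ?_⟩
    rw [map_one, one_mul, mono_neg_natCast, ← neg_add', ← Nat.cast_succ,
      mono_neg_natCast, pow_succ']

theorem exists_mono_mul_mono_neg {i : ℤ} (hi : i ≠ 0) : ∃ (f : k[T;T⁻¹]) (t : kˣ),
    mono q i * mono q (-i) = ofLaurent q f ∧ laurentEval t f = 0 := by
  obtain ⟨n, rfl | rfl⟩ := i.eq_nat_or_neg <;>
    obtain ⟨n, rfl⟩ := Nat.exists_eq_succ_of_ne_zero (n := n) (by rintro rfl; simp at hi)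
  · obtain ⟨f, hf⟩ := exists_pow_mul_pow_eq_laurentEval (semiconjBy_x_z q) (x_mul_y q) n
    refine ⟨_, 1, by rw [mono_natCast, mono_neg_natCast, hf], ?_⟩
    rw [map_mul, map_sub, laurentEval_T_one, map_one, Units.val_one, sub_self, mul_zero]
  · obtain ⟨f, hf⟩ := exists_pow_mul_pow_eq_laurentEval (semiconjBy_y_z q) (y_mul_x q) n
    refine ⟨_, q, by rw [neg_neg, mono_natCast, mono_neg_natCast, hf], ?_⟩
    rw [map_mul, map_sub, map_smul, laurentEval_T_one, map_one, smul_eq_mul,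
      inv_mul_cancel₀ q.ne_zero, sub_self, mul_zero]

theorem exists_toTorus_mono (i : ℤ) : ∃ h ≠ 0, toTorus q (mono q i) = monomial q i h := by
  obtain ⟨n, rfl | rfl⟩ := i.eq_nat_or_neg
  · obtain ⟨h, h0, hn⟩ := exists_monomial_pow q 1 (one_ne_zero (α := k[T;T⁻¹])) n
    exact ⟨h, h0, by rw [mono_natCast, map_pow, toTorus_x, hn, mul_one]⟩
  · obtain ⟨h, h0, hn⟩ := exists_monomial_pow q (-1) (smul_T_one_sub_one_ne_zero q⁻¹) n
    exact ⟨h, h0, by rw [mono_neg_natCast, map_pow, toTorus_y, ← Units.val_inv_eq_inv_val, hn,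
      mul_neg_one]⟩

/-- The expansion `∑ fᵢ(z) xⁱ`, where `x⁻ⁱ` stands for `yⁱ` when `i > 0`. -/
def expansion : (ℤ →₀ k[T;T⁻¹]) →ₗ[k] B1 (q : k) :=
  Finsupp.lsum k fun i => (LinearMap.mulRight k (mono q i)).comp (ofLaurent q).toLinearMap

theorem expansion_single (i : ℤ) (f : k[T;T⁻¹]) :
    expansion q (.single i f) = ofLaurent q f * mono q i := Finsupp.lsum_single _ _ _ _

theorem expansion_surjective : Function.Surjective (expansion q) := by
  rw [← LinearMap.range_eq_top]
  let S : Subalgebra k (B1 (q : k)) :=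
    { carrier := {a | ∀ p ∈ LinearMap.range (expansion q), a * p ∈ LinearMap.range (expansion q)}
      mul_mem' := fun ha hb p hp => by
        rw [mul_assoc]
        exact ha _ (hb p hp)
      add_mem' := fun ha hb p hp => by
        rw [add_mul]
        exact Submodule.add_mem _ (ha p hp) (hb p hp)
      algebraMap_mem' := fun r p hp => by
        rw [← Algebra.smul_def]
        exact Submodule.smul_mem _ r hp }
  have mem_S {a : B1 (q : k)} (ha : ∀ i f, ∃ j g,
      a * (ofLaurent q f * mono q i) = ofLaurent q g * mono q j) : a ∈ S := by
    rintro _ ⟨F, rfl⟩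
    induction F using Finsupp.induction_linear with
    | zero => rw [map_zero, mul_zero]; exact Submodule.zero_mem _
    | add F G hF hG => rw [map_add, mul_add]; exact Submodule.add_mem _ hF hG
    | single i f =>
      obtain ⟨j, g, h⟩ := ha i f
      exact ⟨.single j g, by rw [expansion_single, expansion_single, h]⟩
  have hS : S = ⊤ := by
    refine eq_top_of_mem S (mem_S fun i f => ?_) (mem_S fun i f => ?_) (mem_S fun i f => ?_)
    · obtain ⟨e, he⟩ := exists_x_mul_mono q i
      refine ⟨i + 1, twist q f * e, ?_⟩
      rw [← mul_assoc, (semiconjBy_laurentEval (semiconjBy_x_z q) f).eq, ← laurentEval_twist,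
        mul_assoc, he, map_mul, mul_assoc]
    · obtain ⟨e, he⟩ := exists_y_mul_mono q i
      refine ⟨i - 1, twist q⁻¹ f * e, ?_⟩
      rw [← mul_assoc, (semiconjBy_laurentEval (semiconjBy_y_z q) f).eq, ← laurentEval_twist,
        mul_assoc, he, map_mul, mul_assoc]
    · exact ⟨i, T (-1) * f, by rw [map_mul, laurentEval_T, zpow_neg_one, mul_assoc]⟩
  refine eq_top_iff.mpr fun b _ => ?_
  have h1 : (1 : B1 (q : k)) ∈ LinearMap.range (expansion q) :=
    ⟨.single 0 1, by rw [expansion_single, map_one, one_mul, mono_zero]⟩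
  rw [← mul_one b]
  exact (hS ▸ Algebra.mem_top : b ∈ S) 1 h1

theorem exists_coeff_toTorus_expansion : ∃ h : ℤ → k[T;T⁻¹], (∀ i, h i ≠ 0) ∧ ∀ F i,
    (toTorus q (expansion q F)).coeff (.ofAdd i) = TwistedLaurent.of q (F i * h i) := by
  choose h h0 hh using exists_toTorus_mono q
  refine ⟨h, h0, fun F i => ?_⟩
  induction F using Finsupp.induction_linear with
  | zero => simp only [map_zero, Finsupp.zero_apply, zero_mul, SkewMonoidAlgebra.coeff_zero]
  | add F G hF hG =>
    rw [map_add, map_add, SkewMonoidAlgebra.coeff_add, Finsupp.add_apply, hF, hG,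
      Finsupp.add_apply, add_mul, map_add]
  | single j f =>
    rw [expansion_single, map_mul, toTorus_ofLaurent, hh, monomial_mul_monomial, zero_add,
      zpow_zero, map_one, AlgEquiv.one_apply]
    obtain rfl | hij := eq_or_ne i j
    · rw [coeff_monomial_self, Finsupp.single_eq_same]
    · rw [coeff_monomial_of_ne q hij, Finsupp.single_eq_of_ne hij, zero_mul, map_zero]

/-- The grading of `B₁^q` with `deg x = 1` and `deg y = -1`, read off in the quantum torus. -/
def IsHomogeneous (i : ℤ) (b : B1 (q : k)) : Prop := ∃ f, toTorus q b = monomial q i f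

variable {q}

theorem IsHomogeneous.exists_eq {i : ℤ} {b : B1 (q : k)} (hb : IsHomogeneous q i b) :
    ∃ f, b = ofLaurent q f * mono q i := by
  obtain ⟨F, rfl⟩ := expansion_surjective q b
  obtain ⟨r, hr⟩ := hb
  obtain ⟨h, h0, hF⟩ := exists_coeff_toTorus_expansion q
  refine ⟨F i, ?_⟩
  rw [← expansion_single]
  congr 1
  refine (Finsupp.eq_single_iff.2 ⟨fun j hj => ?_, rfl⟩)
  rw [Finset.mem_singleton]
  by_contra hji
  have hj0 := hF F j
  rw [hr, coeff_monomial_of_ne q hji, eq_comm, map_eq_zero_iff _ (TwistedLaurent.of q).injective]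
    at hj0
  exact mul_ne_zero (Finsupp.mem_support_iff.1 hj) (h0 j) hj0

theorem toTorus_injective : Function.Injective (toTorus q) := by
  refine (injective_iff_map_eq_zero _).2 fun b hb => ?_
  obtain ⟨f, rfl⟩ := IsHomogeneous.exists_eq (i := 0) (q := q) (b := b)
    ⟨0, by rw [hb, monomial_zero]⟩
  rw [mono_zero, mul_one, toTorus_ofLaurent, ← monomial_zero q 0] at hb
  rw [monomial_injective q 0 hb, map_zero, zero_mul]

end B1

end Structure

/-! ### Automorphisms of `B₁ᶜ` -/

section Automorphisms

open LaurentPolynomial QuantumTorus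

variable {k : Type*} [Field k] {q : kˣ}

namespace B1

theorem isHomogeneous_x : IsHomogeneous q 1 (x (q : k)) := ⟨_, toTorus_x q⟩

theorem isHomogeneous_ofLaurent (f : k[T;T⁻¹]) : IsHomogeneous q 0 (ofLaurent q f) :=
  ⟨_, toTorus_ofLaurent q f⟩

namespace IsHomogeneous

variable {i j : ℤ} {a b : B1 (q : k)}

protected theorem mul (ha : IsHomogeneous q i a) (hb : IsHomogeneous q j b) :
    IsHomogeneous q (i + j) (a * b) := by
  obtain ⟨f, hf⟩ := ha
  obtain ⟨g, hg⟩ := hb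
  exact ⟨_, by rw [map_mul, hf, hg, monomial_mul_monomial]⟩

protected theorem pow (ha : IsHomogeneous q i a) (n : ℕ) : IsHomogeneous q (n * i) (a ^ n) := by
  induction n with
  | zero =>
    rw [pow_zero, Nat.cast_zero, zero_mul, ← map_one (ofLaurent q)]
    exact isHomogeneous_ofLaurent 1
  | succ n ih =>
    rw [pow_succ, Nat.cast_succ, add_one_mul]
    exact ih.mul ha

theorem semiconjBy (ha : IsHomogeneous q i a) : SemiconjBy a (z (q : k)) ↑(q ^ i • z (q : k)) := by
  obtain ⟨f, rfl⟩ := ha.exists_eq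
  have h := mono_mul_ofLaurent q i (T 1)
  rw [laurentEval_twist, laurentEval_T_one, laurentEval_T_one] at h
  refine SemiconjBy.mul_left ?_ h
  rw [← laurentEval_T_one (k := k) (q ^ i • z (q : k)), ← laurentEval_twist]
  exact (Commute.all _ _).map (ofLaurent q)

theorem eq_of_ne_zero (ha : IsHomogeneous q i a) (ha' : IsHomogeneous q j a) (h0 : a ≠ 0) :
    i = j := by
  obtain ⟨f, hf⟩ := ha
  obtain ⟨g, hg⟩ := ha'
  by_contra hij
  refine h0 (toTorus_injective ?_)
  have hf0 := coeff_monomial_of_ne q hij g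
  rw [← hg, hf, coeff_monomial_self, map_eq_zero_iff _ (TwistedLaurent.of q).injective] at hf0
  rw [hf, hf0, map_zero, ← monomial_zero]

end IsHomogeneous

theorem mul_mono_mul_mul_mono (i j : ℤ) (f g : k[T;T⁻¹]) :
    ofLaurent q f * mono q i * (ofLaurent q g * mono q j) =
      ofLaurent q (f * twist (q ^ i) g) * (mono q i * mono q j) := by
  rw [map_mul, mul_assoc, ← mul_assoc _ _ (mono q j), mono_mul_ofLaurent]
  noncomm_ring

theorem exists_isHomogeneous_of_mul_eq {a b : B1 (q : k)} {e : k[T;T⁻¹]} (he : e ≠ 0)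
    (hab : a * b = ofLaurent q e) : ∃ i, IsHomogeneous q i a ∧ IsHomogeneous q (-i) b := by
  have hmul : toTorus q a * toTorus q b = monomial q 0 e := by
    rw [← map_mul, hab, toTorus_ofLaurent]
  obtain ⟨g, h, s, t, ha, hb, hgh, -⟩ := exists_eq_single_of_mul_eq_single
    ((map_ne_zero_iff _ (TwistedLaurent.of q).injective).2 he) hmul
  obtain rfl := eq_inv_of_mul_eq_one_right hgh
  exact ⟨g.toAdd, ⟨s, ha⟩, ⟨t, hb⟩⟩

theorem exists_eq_smul_zpow (w : (B1 (q : k))ˣ) :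
    ∃ (r : kˣ) (n : ℤ), w = r • z (q : k) ^ n := by
  have hw : (w : B1 (q : k)) * ↑w⁻¹ = ofLaurent q 1 := by rw [w.mul_inv, map_one]
  obtain ⟨i, hi, hi'⟩ := exists_isHomogeneous_of_mul_eq one_ne_zero hw
  obtain ⟨f, hf⟩ := hi.exists_eq
  obtain ⟨g, hg⟩ := hi'.exists_eq
  rw [hf, hg, mul_mono_mul_mul_mono] at hw
  obtain rfl : i = 0 := by
    by_contra hi0
    obtain ⟨m, t, hm, ht⟩ := exists_mono_mul_mono_neg q hi0
    rw [hm, ← map_mul] at hw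
    have h1 := congrArg (laurentEval t) (ofLaurent_injective q hw)
    rw [map_mul, ht, mul_zero, map_one] at h1
    exact zero_ne_one h1
  rw [neg_zero, mono_zero, mul_one, mul_one] at hw
  obtain ⟨r, n, rfl⟩ := exists_eq_smul_T_of_isUnit
    (IsUnit.of_mul_eq_one _ (ofLaurent_injective q hw))
  refine ⟨r, n, Units.ext ?_⟩
  rw [hf, mono_zero, mul_one, map_smul, laurentEval_T, Units.val_smul, Units.smul_def]

theorem exists_map_z_eq (s : B1 (q : k) ≃ₐ[k] B1 (q : k)) :
    ∃ r : kˣ, s (z (q : k)) = ↑(r • z (q : k)) ∨ s (z (q : k)) = ↑(r • (z (q : k))⁻¹) := by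
  have hmap (s : B1 (q : k) ≃ₐ[k] B1 (q : k)) :
      ∃ (r : kˣ) (n : ℤ), s (z (q : k)) = ↑(r • z (q : k) ^ n) := by
    obtain ⟨r, n, h⟩ := exists_eq_smul_zpow (Units.map (s : B1 (q : k) →* B1 (q : k)) (z (q : k)))
    exact ⟨r, n, congrArg Units.val h⟩
  obtain ⟨r, n, hs⟩ := hmap s
  obtain ⟨l, m, hs'⟩ := hmap s.symm
  have hz : ofLaurent q (((1 : kˣ) : k) • T 1) = ofLaurent q (((l * r ^ m : kˣ) : k) • T (n * m)) :=
    calc ofLaurent q (((1 : kˣ) : k) • T 1) = s (s.symm (z (q : k))) := by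
          rw [Units.val_one, one_smul, laurentEval_T_one, s.apply_symm_apply]
      _ = l • s (ofLaurent q (T m)) := by
          rw [hs', Units.val_smul, laurentEval_T, Units.smul_def, map_smul, Units.smul_def]
      _ = l • ↑((r • z (q : k) ^ n) ^ m) := by
          rw [← laurentEval_T (k := k)]
          exact congrArg _ (map_laurentEval (φ := (s : B1 (q : k) →ₐ[k] B1 (q : k))) hs _)
      _ = ofLaurent q (((l * r ^ m : kˣ) : k) • T (n * m)) := by
          rw [units_smul_zpow, ← zpow_mul, Units.val_smul, smul_smul, map_smul, laurentEval_T,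
            Units.smul_def]
  have hnm := eq_of_smul_T_eq_smul_T (ofLaurent_injective q hz)
  refine ⟨r, ?_⟩
  obtain rfl | rfl := Int.isUnit_iff.1 (IsUnit.of_mul_eq_one _ hnm.symm)
  · exact .inl (by rw [hs, zpow_one])
  · exact .inr (by rw [hs, zpow_neg_one])

end B1

end Automorphisms

section Automorphisms

open LaurentPolynomial QuantumTorus

variable {k : Type*} [Field k] {q : kˣ}

theorem eq_of_semiconjBy_smul {A : Type*} [Ring A] [Algebra k A] {a : A} {w : Aˣ} {r s : kˣ}
    (ha : a ≠ 0) (hr : SemiconjBy a w ↑(r • w)) (hs : SemiconjBy a w ↑(s • w)) : r = s := by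
  have h : (r : k) • (w * a) = (s : k) • (w * a) := by
    rw [← smul_mul_assoc, ← smul_mul_assoc]
    exact hr.eq.symm.trans hs.eq
  exact Units.ext (smul_left_injective k ((Units.mul_right_eq_zero w).not.2 ha) h)

namespace B1

theorem x_ne_zero : x (q : k) ≠ 0 := fun h => one_ne_zero <| monomial_injective q 1 <| by
  rw [← toTorus_x, h, map_zero, monomial_zero]

section MapZ

variable {s : B1 (q : k) ≃ₐ[k] B1 (q : k)} {r : kˣ}

theorem map_x_mul_map_y (hs : s (z (q : k)) = ↑(r • z (q : k))) :
    s (x (q : k)) * s (y (q : k)) = ofLaurent q ((r : k) • T 1 - 1) := by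
  rw [← map_mul, x_mul_y, map_sub, laurentEval_T_one, map_one, map_sub, hs, map_one, map_sub,
    map_one, map_smul, laurentEval_T_one, Units.val_smul, Units.smul_def]

theorem exists_isHomogeneous_map (hs : s (z (q : k)) = ↑(r • z (q : k))) :
    ∃ i, IsHomogeneous q i (s (x (q : k))) ∧ IsHomogeneous q (-i) (s (y (q : k))) :=
  exists_isHomogeneous_of_mul_eq (smul_T_one_sub_one_ne_zero r) (map_x_mul_map_y hs)

theorem IsHomogeneous.map (hs : s (z (q : k)) = ↑(r • z (q : k))) {i j : ℤ}
    (hx : IsHomogeneous q i (s (x (q : k)))) (hy : IsHomogeneous q (-i) (s (y (q : k))))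
    {b : B1 (q : k)} (hb : IsHomogeneous q j b) : IsHomogeneous q (j * i) (s b) := by
  obtain ⟨f, rfl⟩ := hb.exists_eq
  have hf : IsHomogeneous q 0 (s (ofLaurent q f)) := by
    have := map_laurentEval (φ := (s : B1 (q : k) →ₐ[k] B1 (q : k))) hs f
    rw [← laurentEval_twist] at this
    exact this ▸ isHomogeneous_ofLaurent _
  rw [map_mul, ← zero_add (j * i)]
  refine hf.mul ?_
  obtain ⟨n, rfl | rfl⟩ := j.eq_nat_or_neg
  · rw [mono_natCast, map_pow]
    exact hx.pow n
  · rw [mono_neg_natCast, map_pow, neg_mul_comm]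
    exact hy.pow n

theorem symm_map_z (hs : s (z (q : k)) = ↑(r • z (q : k))) :
    s.symm (z (q : k)) = ↑(r⁻¹ • z (q : k)) := by
  rw [s.symm_apply_eq, Units.val_smul, Units.smul_def, map_smul, hs, ← Units.smul_def,
    Units.val_smul, inv_smul_smul]

theorem isHomogeneous_map (hq : (q : k) ^ 2 ≠ 1) (hs : s (z (q : k)) = ↑(r • z (q : k))) :
    IsHomogeneous q 1 (s (x (q : k))) ∧ IsHomogeneous q (-1) (s (y (q : k))) := by
  obtain ⟨i, hx, hy⟩ := exists_isHomogeneous_map hs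
  obtain ⟨j, hj, -⟩ := exists_isHomogeneous_map (symm_map_z hs)
  have hji : j * i = 1 := by
    have h := IsHomogeneous.map hs hx hy hj
    rw [s.apply_symm_apply] at h
    exact h.eq_of_ne_zero isHomogeneous_x x_ne_zero
  obtain rfl | rfl := Int.isUnit_iff.1 (IsUnit.of_mul_eq_one_right _ hji)
  · exact ⟨hx, hy⟩
  · have hsx : SemiconjBy (s (x (q : k))) (z (q : k)) ↑(q • z (q : k)) := by
      have h := ((semiconjBy_x_z q).map s).smul_right r⁻¹
      rwa [Units.val_smul, Units.smul_def q, map_smul, hs, ← Units.smul_def q, smul_comm r⁻¹ q,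
        Units.val_smul, inv_smul_smul, ← Units.val_smul] at h
    have hqq : q = q ^ (-1 : ℤ) :=
      eq_of_semiconjBy_smul ((map_ne_zero_iff _ s.injective).2 x_ne_zero) hsx hx.semiconjBy
    rw [zpow_neg_one, eq_inv_iff_mul_eq_one, ← sq] at hqq
    exact absurd (congrArg Units.val hqq) hq

theorem exists_map_x_eq (hq : (q : k) ^ 2 ≠ 1) (hs : s (z (q : k)) = ↑(r • z (q : k))) :
    s (z (q : k)) = z (q : k) ∧
      ∃ (a : kˣ) (n : ℤ), s (x (q : k)) = ↑(a • z (q : k) ^ n) * x (q : k) := by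
  obtain ⟨hx, hy⟩ := isHomogeneous_map hq hs
  obtain ⟨f, hf⟩ := hx.exists_eq
  obtain ⟨g, hg⟩ := hy.exists_eq
  have hfg : f * twist (q ^ (1 : ℤ)) g * (T 1 - 1) = (r : k) • T 1 - 1 :=
    ofLaurent_injective q <| by
      rw [← map_x_mul_map_y hs, hf, hg, mul_mono_mul_mul_mono, mono_one, mono_neg_one, x_mul_y,
        map_mul]
  obtain rfl : r = 1 := by
    have h1 := congrArg (laurentEval (1 : kˣ)) hfg
    rw [map_mul, map_sub, map_sub, map_smul, laurentEval_T_one, map_one, Units.val_one, sub_self,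
      mul_zero, smul_eq_mul, mul_one, eq_comm, sub_eq_zero] at h1
    exact Units.ext h1
  have hf1 : f * twist (q ^ (1 : ℤ)) g = 1 := by
    have hT : (T 1 - 1 : k[T;T⁻¹]) ≠ 0 := by
      simpa only [Units.val_one, one_smul] using smul_T_one_sub_one_ne_zero (1 : kˣ)
    exact mul_right_cancel₀ hT (by rw [hfg, Units.val_one, one_smul, one_mul])
  obtain ⟨a, n, rfl⟩ := exists_eq_smul_T_of_isUnit (IsUnit.of_mul_eq_one _ hf1)
  refine ⟨by rw [hs, one_smul], a, n, ?_⟩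
  rw [hf, map_smul, laurentEval_T, mono_one, Units.val_smul, Units.smul_def]

end MapZ

theorem algEquiv_ext {s t : B1 (q : k) ≃ₐ[k] B1 (q : k)}
    (hx : s (x (q : k)) = t (x (q : k))) (hz : s (z (q : k)) = t (z (q : k))) : s = t := by
  set u := t⁻¹ * s with hu
  replace hx : u (x (q : k)) = x (q : k) := t.symm_apply_eq.2 hx
  replace hz : u (z (q : k)) = z (q : k) := t.symm_apply_eq.2 hz
  have hxy : x (q : k) * u (y (q : k)) = x (q : k) * y (q : k) := by
    rw [z_eq, map_add, map_one, map_mul, hx] at hz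
    exact add_left_cancel hz
  have hX : monomial q (-1) 1 * toTorus q (x (q : k)) = 1 := by
    rw [toTorus_x, monomial_mul_monomial, map_one, mul_one, neg_add_cancel, ← degreeZero_apply,
      map_one]
  have hy : u (y (q : k)) = y (q : k) := toTorus_injective <| by
    have h := congrArg (monomial q (-1) 1 * toTorus q ·) hxy
    simpa only [map_mul, ← mul_assoc, hX, one_mul] using h
  have hu1 : (u : B1 (q : k) →ₐ[k] B1 (q : k)) = AlgHom.id k _ := algHom_ext hx hy
  exact (inv_mul_eq_one.1 (hu ▸ AlgEquiv.ext fun b => DFunLike.congr_fun hu1 b)).symm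

theorem zpow_map_x {θ : B1 (q : k) ≃ₐ[k] B1 (q : k)} (hz : θ (z (q : k)) = z (q : k))
    (hx : θ (x (q : k)) = z (q : k) * x (q : k)) (n : ℤ) :
    (θ ^ n) (x (q : k)) = ↑(z (q : k) ^ n) * x (q : k) := by
  have hθ (m : ℤ) : θ (↑(z (q : k) ^ m) * x (q : k)) = ↑(z (q : k) ^ (m + 1)) * x (q : k) := by
    have hm := map_laurentEval (φ := (θ : B1 (q : k) →ₐ[k] B1 (q : k))) hz (T m)
    rw [laurentEval_T] at hm
    rw [map_mul, hx, zpow_add_one, Units.val_mul, mul_assoc]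
    exact congrArg (· * _) hm
  induction n using Int.induction_on with
  | zero => rw [zpow_zero, zpow_zero, Units.val_one, one_mul, AlgEquiv.one_apply]
  | succ n ih => rw [add_comm, zpow_one_add, AlgEquiv.mul_apply, ih, hθ, add_comm]
  | pred n ih =>
    apply θ.injective
    rw [hθ, sub_add_cancel, ← ih, ← AlgEquiv.mul_apply, ← zpow_one_add, add_sub_cancel]

section Generation

variable {ξ : B1 (q : k) ≃ₐ[k] B1 (q : k)} {φ : kˣ → (B1 (q : k) ≃ₐ[k] B1 (q : k))}

theorem map_z_eq_smul_inv
    (hξx : ξ (x (q : k)) = -((q : k) • (↑(z (q : k))⁻¹ : B1 (q : k)) * y (q : k)))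
    (hξy : ξ (y (q : k)) = x (q : k)) : ξ (z (q : k)) = ↑(q • (z (q : k))⁻¹) := by
  rw [z_eq, map_add, map_one, map_mul, hξx, hξy, neg_mul, mul_assoc, y_mul_x, map_sub, map_smul,
    laurentEval_T_one, map_one, smul_mul_assoc, mul_sub, mul_smul_comm, Units.inv_mul, smul_sub,
    smul_inv_smul₀ q.ne_zero, mul_one, neg_sub, add_sub_cancel, Units.val_smul, Units.smul_def]

theorem map_smul_z_inv {s : B1 (q : k) ≃ₐ[k] B1 (q : k)} {r : kˣ}
    (hs : s (z (q : k)) = ↑(r • (z (q : k))⁻¹)) :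
    s ((q : k) • (↑(z (q : k))⁻¹ : B1 (q : k))) = ↑((q * r⁻¹) • z (q : k)) := by
  have h := map_laurentEval (φ := (s : B1 (q : k) →ₐ[k] B1 (q : k))) hs (T (-1))
  rw [laurentEval_T, laurentEval_T, zpow_neg_one, units_smul_zpow, zpow_neg_one, zpow_neg_one,
    inv_inv] at h
  rw [map_smul, mul_smul, Units.val_smul, Units.smul_def]
  exact congrArg _ h

theorem exists_eq_zpow_mul (hq : (q : k) ^ 2 ≠ 1) {θ : B1 (q : k) ≃ₐ[k] B1 (q : k)}
    (hθz : θ (z (q : k)) = z (q : k)) (hθx : θ (x (q : k)) = z (q : k) * x (q : k))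
    (hφz : ∀ β, φ β (z (q : k)) = z (q : k)) (hφx : ∀ β, φ β (x (q : k)) = (β : k)⁻¹ • x (q : k))
    {s : B1 (q : k) ≃ₐ[k] B1 (q : k)} {r : kˣ} (hs : s (z (q : k)) = ↑(r • z (q : k))) :
    ∃ (n : ℤ) (β : kˣ), s = θ ^ n * φ β := by
  obtain ⟨hsz, a, n, hsx⟩ := exists_map_x_eq hq hs
  have hθnz : θ ^ n ∈ MulAction.stabilizer _ (z (q : k) : B1 (q : k)) := zpow_mem hθz n
  refine ⟨n, a⁻¹, algEquiv_ext ?_ ?_⟩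
  · rw [AlgEquiv.mul_apply, hφx, Units.val_inv_eq_inv_val, inv_inv, map_smul,
      zpow_map_x hθz hθx, hsx, Units.val_smul, Units.smul_def, smul_mul_assoc]
  · rw [AlgEquiv.mul_apply, hφz, hsz]
    exact hθnz.symm

theorem closure_eq_top (hq : (q : k) ^ 2 ≠ 1)
    (hξx : ξ (x (q : k)) = -((q : k) • (↑(z (q : k))⁻¹ : B1 (q : k)) * y (q : k)))
    (hξy : ξ (y (q : k)) = x (q : k))
    (hφx : ∀ β, φ β (x (q : k)) = (β : k)⁻¹ • x (q : k))
    (hφy : ∀ β, φ β (y (q : k)) = (β : k) • y (q : k)) :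
    Subgroup.closure ({ξ} ∪ Set.range φ) = ⊤ := by
  set G := Subgroup.closure ({ξ} ∪ Set.range φ)
  have hξ : ξ ∈ G := Subgroup.subset_closure (.inl rfl)
  have hφ (β : kˣ) : φ β ∈ G := Subgroup.subset_closure (.inr ⟨β, rfl⟩)
  have hφz (β : kˣ) : φ β (z (q : k)) = z (q : k) := by
    rw [z_eq, map_add, map_one, map_mul, hφx, hφy, smul_mul_smul_comm, inv_mul_cancel₀ β.ne_zero,
      one_smul]
  have hξz := map_z_eq_smul_inv hξx hξy
  have hξz' : ξ ((q : k) • (↑(z (q : k))⁻¹ : B1 (q : k))) = z (q : k) := by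
    rw [map_smul_z_inv hξz, mul_inv_cancel, one_smul]
  have hθz : (ξ * ξ * φ (-1)) (z (q : k)) = z (q : k) := by
    rw [AlgEquiv.mul_apply, AlgEquiv.mul_apply, hφz, hξz, Units.val_smul, Units.smul_def, hξz']
  have hθx : (ξ * ξ * φ (-1)) (x (q : k)) = z (q : k) * x (q : k) := by
    rw [AlgEquiv.mul_apply, AlgEquiv.mul_apply, hφx, Units.val_neg, Units.val_one, inv_neg_one,
      neg_one_smul, map_neg, hξx, neg_neg, map_mul, hξz', hξy]
  have mem_of_map_z {s : B1 (q : k) ≃ₐ[k] B1 (q : k)} {r : kˣ}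
      (hs : s (z (q : k)) = ↑(r • z (q : k))) : s ∈ G := by
    obtain ⟨n, β, rfl⟩ := exists_eq_zpow_mul hq hθz hθx hφz hφx hs
    exact mul_mem (zpow_mem (mul_mem (mul_mem hξ hξ) (hφ _)) n) (hφ β)
  refine eq_top_iff.mpr fun s _ => ?_
  obtain ⟨r, hs | hs⟩ := exists_map_z_eq s
  · exact mem_of_map_z hs
  · refine (mul_mem_cancel_right hξ).1 (mem_of_map_z (r := q * r⁻¹) ?_)
    rw [AlgEquiv.mul_apply, hξz, Units.val_smul, Units.smul_def, map_smul_z_inv hs]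

end Generation

end B1

end Automorphisms

section Main

variable {k : Type*} [Field k] {c : k} {hc : c ≠ 0}

theorem Induces.map_x {f : F2S k ≃ₐ[k] F2S k} {σ : B1 c ≃ₐ[k] B1 c} (h : Induces hc f σ) :
    σ (B1.x c) = toB1 hc (f (F2S.x k)) := by
  rw [← h, toB1_x]

theorem Induces.map_y {f : F2S k ≃ₐ[k] F2S k} {σ : B1 c ≃ₐ[k] B1 c} (h : Induces hc f σ) :
    σ (B1.y c) = toB1 hc (f (F2S.y k)) := by
  rw [← h, toB1_y]

theorem closure_induced_eq_top (hc2 : c ^ 2 ≠ 1) {ξ : B1 c ≃ₐ[k] B1 c}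
    {φ : kˣ → (B1 c ≃ₐ[k] B1 c)} (hξ : Induces hc (F2S.xi k) ξ)
    (hφ : ∀ β, Induces hc (F2S.phi β) (φ β)) : Subgroup.closure ({ξ} ∪ Set.range φ) = ⊤ := by
  obtain ⟨q, rfl⟩ : ∃ q : kˣ, (q : k) = c := ⟨Units.mk0 c hc, rfl⟩
  refine B1.closure_eq_top hc2 ?_ ?_ (fun β => ?_) fun β => ?_
  · rw [hξ.map_x, F2S.xi_x, map_neg, map_mul, toB1_v_inv, toB1_y]
  · rw [hξ.map_y, F2S.xi_y, toB1_x]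
  · rw [(hφ β).map_x, F2S.phi_x, map_smul, toB1_x]
  · rw [(hφ β).map_y, F2S.phi_y, map_smul, toB1_y]

theorem exists_mem_stabilizer_induces {G : Set (B1 c ≃ₐ[k] B1 c)}
    (hG : Subgroup.closure G = ⊤)
    (hind : ∀ σ ∈ G, ∃ f ∈ MulAction.stabilizer (F2S k ≃ₐ[k] F2S k) (F2S.structures k),
      Induces hc f σ) (σ : B1 c ≃ₐ[k] B1 c) :
    ∃ f ∈ MulAction.stabilizer (F2S k ≃ₐ[k] F2S k) (F2S.structures k), Induces hc f σ := by
  have hσ : σ ∈ Subgroup.closure G := hG ▸ Subgroup.mem_top σ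
  induction hσ using Subgroup.closure_induction with
  | mem σ hσ => exact hind σ hσ
  | one => exact ⟨1, one_mem _, .one⟩
  | mul σ τ _ _ hσ hτ =>
    obtain ⟨f, hf, hfσ⟩ := hσ
    obtain ⟨g, hg, hgτ⟩ := hτ
    exact ⟨f * g, mul_mem hf hg, hfσ.mul hgτ⟩
  | inv σ _ hσ =>
    obtain ⟨f, hf, hfσ⟩ := hσ
    exact ⟨f⁻¹, inv_mem hf, hfσ.inv⟩

end Main

theorem mainTheorem10_general {k : Type*} [Field k] [NeZero (2 : k)] (c : k)
    (hc0 : c ≠ 0) (hc1 : c ≠ 1) (hcm1 : c ≠ -1) :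
    ∃ H₁ H₂ : QuasiHamiltonian k (F2S k),
      F2S.IsFirstStructure H₁ ∧ F2S.IsSecondStructure H₂ ∧
      Function.Surjective (toB1 hc0) ∧
      (∀ H ∈ ({H₁, H₂} : Set (QuasiHamiltonian k (F2S k))),
        TwoSidedIdeal.ker (toB1 hc0) =
          TwoSidedIdeal.span {H.moment - algebraMap k (F2S k) c⁻¹}) ∧
      (∃ (ψ ξ : F2S k ≃ₐ[k] F2S k)
          (φ : kˣ → (F2S k ≃ₐ[k] F2S k))
          (ψ' ξ' : B1 c ≃ₐ[k] B1 c)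
          (φ' : kˣ → (B1 c ≃ₐ[k] B1 c)),
        ψ (F2S.x k) = F2S.x k * (F2S.u k : F2S k) ∧
        ψ (F2S.y k) =
          ((F2S.u k)⁻¹ : (F2S k)ˣ) * F2S.y k ∧
        IsQuasiHamiltonianIso H₁ H₂ ψ ∧
        Induces hc0 ψ ψ' ∧
        ξ (F2S.x k) =
          -(((F2S.v k)⁻¹ : (F2S k)ˣ) * F2S.y k) ∧
        ξ (F2S.y k) = F2S.x k ∧
        IsQuasiHamiltonianIso H₁ H₂ ξ ∧
        Induces hc0 ξ ξ' ∧
        (∀ β : kˣ,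
          φ β (F2S.x k) = (β : k)⁻¹ • F2S.x k ∧
          φ β (F2S.y k) = (β : k) • F2S.y k ∧
          IsQuasiHamiltonianIso H₁ H₁ (φ β) ∧
          IsQuasiHamiltonianIso H₂ H₂ (φ β) ∧
          Induces hc0 (φ β) (φ' β)) ∧
        Subgroup.closure ({ψ', ξ'} ∪ Set.range φ') = ⊤) ∧
      (∀ σ : B1 c ≃ₐ[k] B1 c,
        ∃ H ∈ ({H₁, H₂} : Set (QuasiHamiltonian k (F2S k))),
        ∃ H' ∈ ({H₁, H₂} : Set (QuasiHamiltonian k (F2S k))),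
        ∃ f : F2S k ≃ₐ[k] F2S k,
          IsQuasiHamiltonianIso H H' f ∧ Induces hc0 f σ) := by
  have hc2 : c ^ 2 ≠ 1 := fun h => (sq_eq_one_iff.1 h).elim hc1 hcm1
  obtain ⟨ψ', hψ⟩ := exists_induces (hc := hc0) (.inl rfl) (.inr F2S.psi_smul_first)
  obtain ⟨ξ', hξ⟩ := exists_induces (hc := hc0) (.inl rfl) (.inr F2S.xi_smul_first)
  choose φ' hφ using fun β : kˣ =>
    exists_induces (hc := hc0) (.inl rfl) (.inl (F2S.phi_smul_first β))
  have hgen := closure_induced_eq_top hc2 hξ hφ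
  refine ⟨F2S.firstStructure k, F2S.secondStructure k, F2S.isFirstStructure_first k,
    F2S.isSecondStructure_second k, toB1_surjective hc0, fun H hH => ker_toB1 hc0 hH,
    ⟨F2S.psi k, F2S.xi k, F2S.phi, ψ', ξ', φ', F2S.psi_x k, F2S.psi_y k,
      isQuasiHamiltonianIso_iff_smul_eq.2 F2S.psi_smul_first, hψ, F2S.xi_x k, F2S.xi_y k,
      isQuasiHamiltonianIso_iff_smul_eq.2 F2S.xi_smul_first, hξ,
      fun β => ⟨F2S.phi_x β, F2S.phi_y β,
        isQuasiHamiltonianIso_iff_smul_eq.2 (F2S.phi_smul_first β),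
        isQuasiHamiltonianIso_iff_smul_eq.2 (F2S.phi_smul_second β), hφ β⟩, ?_⟩, fun σ => ?_⟩
  · exact top_unique (hgen.ge.trans (Subgroup.closure_mono (Set.union_subset_union_left _
      (Set.singleton_subset_iff.2 (.inr rfl)))))
  · obtain ⟨f, hf, hfσ⟩ := exists_mem_stabilizer_induces hgen (by
      rintro _ (rfl | ⟨β, rfl⟩)
      · exact ⟨_, F2S.xi_mem_stabilizer k, hξ⟩
      · exact ⟨_, F2S.phi_mem_stabilizer β, hφ β⟩) σ
    exact ⟨_, .inl rfl, _, (MulAction.mem_stabilizer_set.1 hf _).2 (.inl rfl), f,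
      isQuasiHamiltonianIso_iff_smul_eq.2 rfl, hfσ⟩

end QuasiHam

end

theorem mainTheorem10 {k : Type*} [Field k] [CharZero k] (c : k)
    (hc0 : c ≠ 0) (hc1 : c ≠ 1) (hcm1 : c ≠ -1) :
    -- the two quasi-Hamiltonian structures exist on `k⟨x, y⟩_S`
    ∃ H₁ H₂ : QuasiHam.QuasiHamiltonian k (QuasiHam.F2S k),
      QuasiHam.F2S.IsFirstStructure H₁ ∧ QuasiHam.F2S.IsSecondStructure H₂ ∧
      -- `B₁ᶜ` is the quotient of `k⟨x, y⟩_S` obtained by setting either moment map to `c⁻¹`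
      Function.Surjective (QuasiHam.toB1 hc0) ∧
      (∀ H ∈ ({H₁, H₂} : Set (QuasiHam.QuasiHamiltonian k (QuasiHam.F2S k))),
        TwoSidedIdeal.ker (QuasiHam.toB1 hc0) =
          TwoSidedIdeal.span {H.moment - algebraMap k (QuasiHam.F2S k) c⁻¹}) ∧
      -- explicit isomorphisms, inducing generators of the automorphism group of `B₁ᶜ`
      (∃ (ψ ξ : QuasiHam.F2S k ≃ₐ[k] QuasiHam.F2S k)
          (φ : kˣ → (QuasiHam.F2S k ≃ₐ[k] QuasiHam.F2S k))
          (ψ' ξ' : QuasiHam.B1 c ≃ₐ[k] QuasiHam.B1 c)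
          (φ' : kˣ → (QuasiHam.B1 c ≃ₐ[k] QuasiHam.B1 c)),
        ψ (QuasiHam.F2S.x k) = QuasiHam.F2S.x k * (QuasiHam.F2S.u k : QuasiHam.F2S k) ∧
        ψ (QuasiHam.F2S.y k) =
          ((QuasiHam.F2S.u k)⁻¹ : (QuasiHam.F2S k)ˣ) * QuasiHam.F2S.y k ∧
        QuasiHam.IsQuasiHamiltonianIso H₁ H₂ ψ ∧
        QuasiHam.Induces hc0 ψ ψ' ∧
        ξ (QuasiHam.F2S.x k) =
          -(((QuasiHam.F2S.v k)⁻¹ : (QuasiHam.F2S k)ˣ) * QuasiHam.F2S.y k) ∧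
        ξ (QuasiHam.F2S.y k) = QuasiHam.F2S.x k ∧
        QuasiHam.IsQuasiHamiltonianIso H₁ H₂ ξ ∧
        QuasiHam.Induces hc0 ξ ξ' ∧
        (∀ β : kˣ,
          φ β (QuasiHam.F2S.x k) = (β : k)⁻¹ • QuasiHam.F2S.x k ∧
          φ β (QuasiHam.F2S.y k) = (β : k) • QuasiHam.F2S.y k ∧
          QuasiHam.IsQuasiHamiltonianIso H₁ H₁ (φ β) ∧
          QuasiHam.IsQuasiHamiltonianIso H₂ H₂ (φ β) ∧
          QuasiHam.Induces hc0 (φ β) (φ' β)) ∧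
        Subgroup.closure ({ψ', ξ'} ∪ Set.range φ') = ⊤) ∧
      -- every automorphism of `B₁ᶜ` is induced by an isomorphism of quasi-Hamiltonian algebras
      (∀ σ : QuasiHam.B1 c ≃ₐ[k] QuasiHam.B1 c,
        ∃ H ∈ ({H₁, H₂} : Set (QuasiHam.QuasiHamiltonian k (QuasiHam.F2S k))),
        ∃ H' ∈ ({H₁, H₂} : Set (QuasiHam.QuasiHamiltonian k (QuasiHam.F2S k))),
        ∃ f : QuasiHam.F2S k ≃ₐ[k] QuasiHam.F2S k,
          QuasiHam.IsQuasiHamiltonianIso H H' f ∧ QuasiHam.Induces hc0 f σ) := by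
  exact QuasiHam.mainTheorem10_general c hc0 hc1 hcm1
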